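/- **Definitions.** An *$\omega$-quasi-Borel space* ($\omega$qbs) $X$ is a set $|X|$ with a partial order in which every $\omega$-chain has a least upper bound, and a set $M_X$ of functions $\mathbb R\to|X|$ (the random elements) that contains the constants and is closed under precomposition with Borel functions $\mathbb R\to\mathbb R$, under case-splitting along countable Borel partitions of $\mathbb R$, and under pointwise least upper bounds of $\omega$-chains. Morphisms are the Scott-continuous functions $f$ (monotone and preserving lubs of $\omega$-chains) with $f\circ\alpha\in M_Y$ for all $\alpha\in M_X$; they form the category $\omega\mathbf{Qbs}$. Let $\mathbb R$ be the real line with the discrete order and the Borel functions as random elements, and $\mathbb W=[0,\infty]$ with its usual order and the Borel functions as random elements. Products have componentwise order and random elements; the exponential $Y^X$ is the set of morphisms $X\to Y$ with the pointwise order and the curried morphisms $\mathbb R\times X\to Y$ as random elements; the lifting $X_\bot$ adjoins a least element $\bot$, and its random elements are those functions that, for some Borel set $B$, coincide on $B$ with a random element of $X$ and are $\bot$ off $B$ (with $B=\emptyset$ if $X$ is empty). Let $JX=\mathbb W^{\mathbb W^X}$ and $RX=(X_\bot)^{\mathbb R}$. For $\alpha\in RX$ let $\mathbb E_\alpha\in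 JX$ be $\mathbb E_\alpha[w]=\int_{\{r:\alpha(r)\ne\bot\}}w(\alpha(r))\,dr$ (Lebesgue integral). The *statistical powerdomain* $TX$ has as elements the closure of $\{\mathbb E_\alpha:\alpha\in RX\}\subseteq JX$ under lubs of $\omega$-chains, with the order of $JX$, and as random elements the closure of $\{\mathbb E\circ\gamma:\gamma\in M_{RX}\}$ under pointwise lubs of $\omega$-chains. A *strong monad* on a Cartesian closed category consists of objects $TX$ and morphisms $\mathrm{return}_X:X\to TX$ and $\mathbin{>\!\!>\!=}_{X,Y}:TX\times(TY)^X\to TY$ satisfying, in the internal language, $(\mathrm{return}\,x\mathbin{>\!\!>\!=}f)=f(x)$, $(a\mathbin{>\!\!>\!=}\mathrm{return})=a$ and $((a\mathbin{>\!\!>\!=}f)\mathbin{>\!\!>\!=}g)=(a\mathbin{>\!\!>\!=}\lambda x.\,f(x)\mathbin{>\!\!>\!=}g)$. It is *commutative* if $a\mathbin{>\!\!>\!=}\lambda x.\,b\mathbin{>\!\!>\!=}\lambda y.\,\mathrm{return}(x,y)=b\mathbin{>\!\!>\!=}\lambda y.\,a\mathbin{>\!\!>\!=}\lambda x.\,\mathrm{return}(x,y)$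 for $a:TX$, $b:TY$. A *measure category* is a Cartesian closed category with countable limits and countable coproducts and a commutative strong monad $T$ such that the morphism $T0\to1$ is invertible and, for every sequence $(X_i)_{i\in\mathbb N}$ of objects, the morphism $$T\Big(\sum_{i\in\mathbb N}X_i\Big)\to\prod_{j\in\mathbb N}TX_j,\qquad a\mapsto\big(a\mathbin{>\!\!>\!=}[\delta_{i,j}]_i\big)_j$$ is invertible, where $\delta_{i,i}=\mathrm{return}_{X_i}$ and, for $i\ne j$, $\delta_{i,j}:X_i\to TX_j$ is constantly the zero element, i.e. the image of the element of $T0\cong1$ under $T(0\to X_j)$. The scalars $T1$ of a measure category have the countable addition $\prod_{n\in\mathbb N}T1\cong T(\sum_{n\in\mathbb N}1)\to T1$ (hence the binary addition $a+b=a+b+0+0+\cdots$), the zero element as $0$, the multiplication $a\cdot b=(a\mathbin{>\!\!>\!=}\lambda\_.\,b)$, and $\mathrm{return}(\ast)$ as $1$. **Theorem.** The assignment $T$ carries a (unique) strong monad structure on $\omega\mathbf{Qbs}$ that is the restriction of that of $J$, i.e. $(\mathrm{return}\,x)[w]=w(x)$ and $(a\mathbin{>\!\!>\!=}f)[w]=a[\lambda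 x.\,f(x)[w]]$, and this structure makes $\omega\mathbf{Qbs}$ into a measure category; in particular, $T$ is a commutative monad. There is an isomorphism $T1\cong\mathbb W$ of $\omega$qbses that carries the countable and binary addition, the zero, the multiplication and the unit of the scalars $T1$ to the usual ones of $[0,\infty]$. For every $\omega$qbs $X$, every $\mu\in TX$ is linear: $\mu[v+w]=\mu[v]+\mu[w]$ and $\mu[c\cdot w]=c\cdot\mu[w]$ for all morphisms $v,w:X\to\mathbb W$ and all $c\in[0,\infty]$. -/

import Mathlib

open CategoryTheory MonoidalCategory CartesianMonoidalCategory Limits MeasureTheory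
open OmegaCompletePartialOrder
open scoped ENNReal

universe u v w

noncomputable section

/-- An `ω`-quasi-Borel space: a carrier with an `ω`-cpo structure and a set of random elements,
which contains the constants, is closed under precomposition with Borel functions, under countable
Borel case-splitting, and under pointwise suprema of `ω`-chains. -/
structure WQbs : Type (u + 1) where
  carrier : Type u
  [order : OmegaCompletePartialOrder carrier]
  Random : Set (ℝ → carrier)
  random_const : ∀ x : carrier, (fun _ => x) ∈ Random
  random_comp : ∀ α ∈ Random, ∀ f : ℝ → ℝ, Measurable f → (fun r => α (f r)) ∈ Random
  /-- A countable Borel partition of `ℝ` is given by the measurable function `N` sending a point to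
  the index of its cell. -/
  random_split : ∀ N : ℝ → ℕ, Measurable N → ∀ α : ℕ → ℝ → carrier, (∀ n, α n ∈ Random) →
    (fun r => α (N r) r) ∈ Random
  random_ωSup : ∀ c : Chain (ℝ → carrier), (∀ n, c n ∈ Random) → ωSup c ∈ Random

namespace WQbs

instance : CoeSort WQbs.{u} (Type u) := ⟨carrier⟩

instance (X : WQbs.{u}) : OmegaCompletePartialOrder X := X.order

/-- Morphisms: Scott-continuous functions that preserve random elements. -/
structure Hom (X : WQbs.{u}) (Y : WQbs.{v}) where
  toFun : X → Y
  cont : ωScottContinuous toFun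
  random : ∀ α ∈ X.Random, (fun r => toFun (α r)) ∈ Y.Random

namespace Hom

variable {X : WQbs.{u}} {Y : WQbs.{v}} {Z : WQbs.{w}}

instance : FunLike (Hom X Y) X Y where
  coe := toFun
  coe_injective f g h := by cases f; cases g; congr

@[ext] theorem ext {f g : Hom X Y} (h : ∀ x, f x = g x) : f = g := DFunLike.ext _ _ h

def id (X : WQbs.{u}) : Hom X X := ⟨fun x => x, ωScottContinuous.id, fun _ h => h⟩

def comp (g : Hom Y Z) (f : Hom X Y) : Hom X Z :=
  ⟨fun x => g (f x), g.cont.comp f.cont, fun α h => g.random _ (f.random α h)⟩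

/-- Morphisms are ordered pointwise. -/
instance : PartialOrder (Hom X Y) := PartialOrder.lift (fun f => (f : X → Y)) DFunLike.coe_injective

theorem le_def {f g : Hom X Y} : f ≤ g ↔ ∀ x, f x ≤ g x := Iff.rfl

def toContinuousHom : Hom X Y →o (X →𝒄 Y) where
  toFun f := ContinuousHom.ofFun f f.cont
  monotone' _ _ h := h

/-- Suprema of chains of morphisms are computed pointwise. -/
def ωSupHom (c : Chain (Hom X Y)) : Hom X Y where
  toFun x := ωSup (c.map (toContinuousHom (X := X) (Y := Y))) x
  cont := (ωSup (c.map toContinuousHom)).ωScottContinuous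
  random α h :=
    Y.random_ωSup ⟨⟨fun n r => c n (α r), fun _ _ hmn r => le_def.1 (c.monotone hmn) (α r)⟩⟩
      (fun n => (c n).random α h)

instance : OmegaCompletePartialOrder (Hom X Y) :=
  OmegaCompletePartialOrder.lift toContinuousHom ωSupHom (fun _ _ h => h) (fun _ => rfl)

end Hom

/-- A set with the discrete (equality) order. -/
def Discr (α : Type u) : Type u := α

instance (α : Type u) : PartialOrder (Discr α) where
  le x y := x = y
  le_refl _ := rfl
  le_trans _ _ _ := Eq.trans
  le_antisymm _ _ h _ := h

instance (α : Type u) : OmegaCompletePartialOrder (Discr α) where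
  ωSup c := c 0
  le_ωSup c i := (c.monotone (Nat.zero_le i) : c 0 = c i).symm
  ωSup_le _ _ h := h 0

/-- The real line: measurable random elements, discrete order. -/
abbrev real : WQbs.{0} where
  carrier := Discr ℝ
  Random := {α | @Measurable ℝ ℝ _ _ α}
  random_const _ := measurable_const
  random_comp _ hα _ hf := Measurable.comp hα hf
  random_split _ hN α hα :=
    (measurable_from_prod_countable_right (f := fun p : ℕ × ℝ => (α p.1 p.2 : ℝ)) hα).comp
      (hN.prodMk measurable_id)
  random_ωSup _ h := h 0

/-- The weights `[0,∞]`: measurable random elements, usual order. -/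
abbrev weight : WQbs.{0} where
  carrier := ℝ≥0∞
  Random := {α | Measurable α}
  random_const _ := measurable_const
  random_comp _ hα _ hf := Measurable.comp hα hf
  random_split _ hN α hα :=
    (measurable_from_prod_countable_right (f := fun p : ℕ × ℝ => α p.1 p.2) hα).comp
      (hN.prodMk measurable_id)
  random_ωSup c h := by
    have : (ωSup c : ℝ → ℝ≥0∞) = fun r => ⨆ n, c n r := rfl
    change Measurable (ωSup c : ℝ → ℝ≥0∞)
    rw [this]
    exact Measurable.iSup h

/-- The terminal space. -/
abbrev unit : WQbs.{u} where
  carrier := Discr PUnit.{u + 1}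
  Random := Set.univ
  random_const _ := trivial
  random_comp _ _ _ _ := trivial
  random_split _ _ _ _ := trivial
  random_ωSup _ _ := trivial

/-- Binary products. -/
abbrev prod (X : WQbs.{u}) (Y : WQbs.{v}) : WQbs.{max u v} where
  carrier := X × Y
  Random := {γ | (fun r => (γ r).1) ∈ X.Random ∧ (fun r => (γ r).2) ∈ Y.Random}
  random_const p := ⟨X.random_const p.1, Y.random_const p.2⟩
  random_comp _ h f hf := ⟨X.random_comp _ h.1 f hf, Y.random_comp _ h.2 f hf⟩
  random_split N hN γ h :=
    ⟨X.random_split N hN (fun n r => (γ n r).1) fun n => (h n).1,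
      Y.random_split N hN (fun n r => (γ n r).2) fun n => (h n).2⟩
  random_ωSup c h :=
    ⟨X.random_ωSup ⟨⟨fun n r => (c n r).1, fun _ _ hmn r => (c.monotone hmn r).1⟩⟩
        fun n => (h n).1,
      Y.random_ωSup ⟨⟨fun n r => (c n r).2, fun _ _ hmn r => (c.monotone hmn r).2⟩⟩
        fun n => (h n).2⟩

section Exponential

variable {X : WQbs.{u}} {Y : WQbs.{v}} {Z : WQbs.{w}}

def fstHom : Hom (prod X Y) X := ⟨Prod.fst, Prod.ωScottContinuous_fst, fun _ h => h.1⟩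

def sndHom : Hom (prod X Y) Y := ⟨Prod.snd, Prod.ωScottContinuous_snd, fun _ h => h.2⟩

def pairHom (f : Hom Z X) (g : Hom Z Y) : Hom Z (prod X Y) :=
  ⟨fun z => (f z, g z), Prod.ωScottContinuous.prodMk f.cont g.cont,
    fun α h => ⟨f.random α h, g.random α h⟩⟩

theorem continuous_discr_prod {α : Type u} {β : Type v} {γ : Type w}
    [OmegaCompletePartialOrder β] [OmegaCompletePartialOrder γ] (f : Discr α × β → γ)
    (hf : ∀ a, ωScottContinuous fun b => f (a, b)) : ωScottContinuous f := by
  refine ωScottContinuous.of_monotone_map_ωSup ⟨?_, ?_⟩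
  · rintro ⟨a, b⟩ ⟨a', b'⟩ ⟨h₁, h₂⟩
    obtain rfl : a = a' := h₁
    exact (hf a).monotone h₂
  · intro c
    have h0 : ∀ n, (c n).1 = (c 0).1 := fun n =>
      ((c.monotone (Nat.zero_le n)).1 : (c 0).1 = (c n).1).symm
    have h1 : ωSup c = ((c 0).1, ωSup (c.map OrderHom.snd)) := rfl
    rw [h1, (hf (c 0).1).map_ωSup]
    congr 1
    ext n
    change f ((c 0).1, (c n).2) = f (c n)
    rw [← h0 n]

/-- The random elements of the exponential: curried morphisms `ℝ × X → Y`. -/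
def expRandom (X : WQbs.{u}) (Y : WQbs.{v}) : Set (ℝ → Hom X Y) :=
  {f | ∃ F : Hom (prod real X) Y, ∀ (r : ℝ) (x : X), F (r, x) = f r x}

theorem mem_expRandom_iff (f : ℝ → Hom X Y) :
    f ∈ expRandom X Y ↔ ∀ ρ : ℝ → ℝ, Measurable ρ → ∀ ξ ∈ X.Random,
      (fun r => f (ρ r) (ξ r)) ∈ Y.Random := by
  constructor
  · rintro ⟨F, hF⟩ ρ hρ ξ hξ
    have := F.random (fun r => (ρ r, ξ r)) ⟨hρ, hξ⟩
    convert this using 2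
    exact (hF _ _).symm
  · intro h
    exact ⟨⟨fun p => f p.1 p.2, continuous_discr_prod _ fun a => (f a).cont,
      fun γ hγ => h _ hγ.1 _ hγ.2⟩, fun _ _ => rfl⟩

/-- The exponential `Y ^ X`. -/
abbrev exp (X : WQbs.{u}) (Y : WQbs.{v}) : WQbs.{max u v} where
  carrier := Hom X Y
  Random := expRandom X Y
  random_const f := (mem_expRandom_iff _).2 fun _ _ ξ hξ => f.random ξ hξ
  random_comp _ hf _ hg := (mem_expRandom_iff _).2 fun _ hρ ξ hξ =>
    (mem_expRandom_iff _).1 hf _ (hg.comp hρ) ξ hξ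
  random_split N hN f hf := (mem_expRandom_iff _).2 fun ρ hρ ξ hξ =>
    Y.random_split (fun r => N (ρ r)) (hN.comp hρ) (fun n r => f n (ρ r) (ξ r))
      fun n => (mem_expRandom_iff _).1 (hf n) ρ hρ ξ hξ
  random_ωSup c hc := (mem_expRandom_iff _).2 fun ρ hρ ξ hξ =>
    Y.random_ωSup ⟨⟨fun n r => c n (ρ r) (ξ r), fun _ _ hmn r => Hom.le_def.1 (c.monotone hmn (ρ r)) (ξ r)⟩⟩
      fun n => (mem_expRandom_iff _).1 (hc n) ρ hρ ξ hξ

def evalHom : Hom (prod X (exp X Y)) Y where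
  toFun p := Hom.toFun p.2 p.1
  cont := by
    have h : ωScottContinuous fun p : X × Hom X Y =>
        ContinuousHom.Prod.apply (Hom.toContinuousHom p.2, p.1) :=
      ContinuousHom.Prod.apply.ωScottContinuous.comp
        (Prod.ωScottContinuous.prodMk
          ((ωScottContinuous.of_map_ωSup_of_orderHom (f := Hom.toContinuousHom)
            fun _ => rfl).comp Prod.ωScottContinuous_snd) Prod.ωScottContinuous_fst)
    exact h
  random γ h := (mem_expRandom_iff _).1 h.2 _ measurable_id _ h.1

def curryHom (f : Hom (prod X Z) Y) : Hom Z (exp X Y) where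
  toFun z := ⟨fun x => f (x, z),
    f.cont.comp (Prod.ωScottContinuous.prodMk ωScottContinuous.id ωScottContinuous.const),
    fun ξ hξ => f.random _ ⟨hξ, Z.random_const z⟩⟩
  cont := by
    refine ωScottContinuous.of_monotone_map_ωSup
      ⟨fun z z' h => Hom.le_def.2 fun x => f.cont.monotone (a := (x, z)) (b := (x, z')) ⟨le_rfl, h⟩, fun c => Hom.ext fun x => ?_⟩
    exact (f.cont.comp (Prod.ωScottContinuous.prodMk (ωScottContinuous.const (x := x))
      ωScottContinuous.id)).map_ωSup c
  random ζ hζ := (mem_expRandom_iff _).2 fun ρ hρ ξ hξ =>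
    f.random (fun r => (ξ r, ζ (ρ r))) ⟨hξ, Z.random_comp ζ hζ ρ hρ⟩

end Exponential

section Lifting

variable {α : Type u} [OmegaCompletePartialOrder α]

theorem bot_ne_chain (c : Chain (WithBot α)) {k : ℕ} (hk : c k ≠ ⊥) (n : ℕ) : c (k + n) ≠ ⊥ :=
  ne_bot_of_le_ne_bot hk (c.monotone (Nat.le_add_right k n))

/-- The part of a chain in `α_⊥` from a proper element on. -/
def chainTail (c : Chain (WithBot α)) {k : ℕ} (hk : c k ≠ ⊥) : Chain α :=
  ⟨⟨fun n => (c (k + n)).unbot (bot_ne_chain c hk n), fun m n hmn => by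
    rw [← WithBot.coe_le_coe, WithBot.coe_unbot, WithBot.coe_unbot]
    exact c.monotone (Nat.add_le_add_left hmn k)⟩⟩

theorem coe_chainTail (c : Chain (WithBot α)) {k : ℕ} (hk : c k ≠ ⊥) (n : ℕ) :
    ((chainTail c hk n : α) : WithBot α) = c (k + n) := WithBot.coe_unbot _ _

open Classical in
/-- Adjoining a least element to an `ω`-cpo. -/
instance : OmegaCompletePartialOrder (WithBot α) where
  ωSup c := if h : ∃ k, c k ≠ ⊥ then ((ωSup (chainTail c h.choose_spec) : α) : WithBot α) else ⊥
  le_ωSup c i := by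
    by_cases h : ∃ k, c k ≠ ⊥
    · rw [dif_pos h]
      refine le_trans (c.monotone (Nat.le_add_left i h.choose)) ?_
      change c (h.choose + i) ≤ _
      rw [← coe_chainTail c h.choose_spec i, WithBot.coe_le_coe]
      exact le_ωSup _ i
    · rw [dif_neg h]
      push Not at h
      exact (h i).le
  ωSup_le c x hx := by
    by_cases h : ∃ k, c k ≠ ⊥
    · rw [dif_pos h]
      have hx' : x ≠ ⊥ := ne_bot_of_le_ne_bot h.choose_spec (hx _)
      rw [← WithBot.coe_unbot x hx', WithBot.coe_le_coe]
      refine ωSup_le _ _ fun n => ?_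
      rw [← WithBot.coe_le_coe, WithBot.coe_unbot, coe_chainTail]
      exact hx _
    · rw [dif_neg h]
      exact bot_le

variable {X : WQbs.{u}}

/-- The random elements of `X_⊥`: a random element of `X` on a Borel set `B`, and `⊥` off `B`.
(If `X` is empty then so is `B`.) -/
def liftRandom (X : WQbs.{u}) : Set (ℝ → WithBot X) :=
  {β | ∃ B : Set ℝ, MeasurableSet B ∧ (∀ r ∉ B, β r = ⊥) ∧
    (B.Nonempty → ∃ α ∈ X.Random, ∀ r ∈ B, β r = (α r : WithBot X))}

theorem bot_mem_liftRandom : (fun _ => ⊥) ∈ liftRandom X :=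
  ⟨∅, MeasurableSet.empty, fun _ _ => rfl, fun h => absurd h Set.not_nonempty_empty⟩

theorem random_ite (X : WQbs.{u}) {B : Set ℝ} (hB : MeasurableSet B) {α β : ℝ → X}
    (hα : α ∈ X.Random) (hβ : β ∈ X.Random) (γ : ℝ → X) (h₁ : ∀ r ∈ B, γ r = α r)
    (h₂ : ∀ r ∉ B, γ r = β r) : γ ∈ X.Random := by
  classical
  have := X.random_split (fun r => if r ∈ B then 0 else 1)
    (Measurable.ite hB measurable_const measurable_const)
    (fun n => if n = 0 then α else β) (fun n => by split_ifs <;> assumption)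
  convert this using 2 with r
  by_cases hr : r ∈ B <;> simp [hr, h₁, h₂]

theorem mem_liftRandom_iff (x₀ : X) (β : ℝ → WithBot X) :
    β ∈ liftRandom X ↔ MeasurableSet {r | β r ≠ ⊥} ∧ (fun r => (β r).unbotD x₀) ∈ X.Random := by
  constructor
  · rintro ⟨B, hB, h₁, h₂⟩
    obtain rfl | hne := B.eq_empty_or_nonempty
    · have : ∀ r, β r = ⊥ := fun r => h₁ r (by simp)
      simp only [this, ne_eq, not_true_eq_false, Set.ofPred_false, WithBot.unbotD_bot]
      exact ⟨MeasurableSet.empty, X.random_const x₀⟩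
    · obtain ⟨α, hα, h⟩ := h₂ hne
      have hB' : {r | β r ≠ ⊥} = B := by
        ext r
        by_cases hr : r ∈ B
        · simp [hr, h r hr]
        · simp [hr, h₁ r hr]
      rw [hB']
      refine ⟨hB, random_ite X hB hα (X.random_const x₀) _ (fun r hr => ?_) fun r hr => ?_⟩
      · simp [h r hr]
      · simp [h₁ r hr]
  · rintro ⟨h₁, h₂⟩
    refine ⟨_, h₁, fun r hr => by simpa using hr, fun _ => ⟨_, h₂, fun r hr => ?_⟩⟩
    obtain ⟨x, hx⟩ := WithBot.ne_bot_iff_exists.1 hr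
    simp [← hx]

theorem mem_liftRandom_of_isEmpty [IsEmpty X] (β : ℝ → WithBot X) : β ∈ liftRandom X := by
  convert bot_mem_liftRandom (X := X) using 2 with r
  cases h : β r with
  | bot => rfl
  | coe x => exact isEmptyElim x

theorem liftRandom_split (N : ℝ → ℕ) (hN : Measurable N) (β : ℕ → ℝ → WithBot X)
    (hβ : ∀ n, β n ∈ liftRandom X) : (fun r => β (N r) r) ∈ liftRandom X := by
  obtain h | ⟨⟨x₀⟩⟩ := isEmpty_or_nonempty X
  · exact mem_liftRandom_of_isEmpty _
  · simp only [mem_liftRandom_iff x₀] at hβ ⊢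
    refine ⟨?_, X.random_split N hN (fun n r => (β n r).unbotD x₀) fun n => (hβ n).2⟩
    have : {r | β (N r) r ≠ ⊥} = ⋃ n, N ⁻¹' {n} ∩ {r | β n r ≠ ⊥} := by
      ext r
      simp
    rw [this]
    exact MeasurableSet.iUnion fun n => (hN (measurableSet_singleton n)).inter (hβ n).1

theorem ωSup_withBot_eq (c : Chain (WithBot α)) (d : Chain α) (k : ℕ)
    (h : ∀ n, (d n : WithBot α) = c (max n k)) : ωSup c = ((ωSup d : α) : WithBot α) := by
  refine le_antisymm (ωSup_le _ _ fun n => ?_) ?_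
  · refine (c.monotone (le_max_left n k)).trans ?_
    change c (max n k) ≤ _
    rw [← h n, WithBot.coe_le_coe]
    exact le_ωSup _ _
  · have hne : ωSup c ≠ ⊥ := by
      refine ne_bot_of_le_ne_bot ?_ (le_ωSup c (max 0 k))
      rw [← h 0]
      exact WithBot.coe_ne_bot
    rw [← WithBot.coe_unbot (ωSup c) hne, WithBot.coe_le_coe]
    refine ωSup_le _ _ fun n => ?_
    rw [← WithBot.coe_le_coe, WithBot.coe_unbot, h n]
    exact le_ωSup _ _

theorem ωSup_withBot_ne_bot (c : Chain (WithBot α)) : ωSup c ≠ ⊥ ↔ ∃ n, c n ≠ ⊥ := by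
  constructor
  · intro h
    by_contra! h'
    exact h (le_bot_iff.1 (ωSup_le _ _ fun n => (h' n).le))
  · rintro ⟨n, hn⟩
    exact ne_bot_of_le_ne_bot hn (le_ωSup c n)

theorem liftRandom_ωSup (c : Chain (ℝ → WithBot X)) (hc : ∀ n, c n ∈ liftRandom X) :
    ωSup c ∈ liftRandom X := by
  classical
  obtain h | ⟨⟨x₀⟩⟩ := isEmpty_or_nonempty X
  · exact mem_liftRandom_of_isEmpty _
  simp only [mem_liftRandom_iff x₀] at hc ⊢
  have hsup : ∀ r, ωSup c r = ωSup (c.map (Pi.evalOrderHom r)) := fun _ => rfl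
  have hD : {r | ωSup c r ≠ ⊥} = ⋃ n, {r | c n r ≠ ⊥} := by
    ext r
    simp only [hsup, Set.mem_ofPred_eq, ωSup_withBot_ne_bot, Set.mem_iUnion]
    rfl
  have hDm : MeasurableSet {r | ωSup c r ≠ ⊥} := by
    rw [hD]
    exact MeasurableSet.iUnion fun n => (hc n).1
  refine ⟨hDm, ?_⟩
  have hp : ∀ r, ∃ n, c n r ≠ ⊥ ∨ ωSup c r = ⊥ := fun r => by
    by_cases h : ωSup c r = ⊥
    · exact ⟨0, Or.inr h⟩
    · obtain ⟨n, hn⟩ := (ωSup_withBot_ne_bot (c.map (Pi.evalOrderHom r))).1 h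
      exact ⟨n, Or.inl hn⟩
  have hk : Measurable fun r => Nat.find (hp r) := by
    have : {r | ωSup c r = ⊥} = {r | ωSup c r ≠ ⊥}ᶜ := by
      ext r
      simp
    have hm : MeasurableSet {r | ωSup c r = ⊥} := this ▸ hDm.compl
    exact measurable_find hp fun n => (hc n).1.union hm
  have hne : ∀ r, ωSup c r ≠ ⊥ → ∀ n, Nat.find (hp r) ≤ n → c n r ≠ ⊥ := fun r hr n hn =>
    ne_bot_of_le_ne_bot ((Nat.find_spec (hp r)).resolve_right hr) (c.monotone hn r)
  have hbot : ∀ r, ωSup c r = ⊥ → ∀ n, c n r = ⊥ := fun r hr n =>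
    le_bot_iff.1 ((le_ωSup c n r).trans hr.le)
  let d : Chain (ℝ → X) := ⟨⟨fun n r => (c (max n (Nat.find (hp r))) r).unbotD x₀, by
    intro m n hmn r
    by_cases hr : ωSup c r = ⊥
    · simp only [hbot r hr, WithBot.unbotD_bot, le_refl]
    · obtain ⟨x, hx⟩ := WithBot.ne_bot_iff_exists.1 (hne r hr _ (le_max_right m _))
      obtain ⟨y, hy⟩ := WithBot.ne_bot_iff_exists.1 (hne r hr _ (le_max_right n _))
      have := c.monotone (max_le_max_right (Nat.find (hp r)) hmn) r
      change c _ r ≤ c _ r at this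
      rw [← hx, ← hy, WithBot.coe_le_coe] at this
      simpa [← hx, ← hy] using this⟩⟩
  have hd : ∀ n, d n ∈ X.Random := fun n =>
    X.random_split (fun r => max n (Nat.find (hp r))) (measurable_const.max hk)
      (fun m r => (c m r).unbotD x₀) fun m => (hc m).2
  convert X.random_ωSup d hd using 1
  funext r
  by_cases hr : ωSup c r = ⊥
  · rw [hr, WithBot.unbotD_bot]
    refine le_antisymm (le_ωSup_of_le (c := d.map (Pi.evalOrderHom r)) 0 ?_)
      (ωSup_le (d.map (Pi.evalOrderHom r)) _ fun n => ?_)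
    · change x₀ ≤ (c _ r).unbotD x₀
      simp [hbot r hr]
    · change (c _ r).unbotD x₀ ≤ x₀
      simp [hbot r hr]
  · rw [hsup, ωSup_withBot_eq _ (d.map (Pi.evalOrderHom r)) (Nat.find (hp r)), WithBot.unbotD_coe]
    · rfl
    · intro n
      change (((c (max n (Nat.find (hp r))) r).unbotD x₀ : X) : WithBot X) = c _ r
      obtain ⟨x, hx⟩ := WithBot.ne_bot_iff_exists.1 (hne r hr _ (le_max_right n _))
      simp [← hx]

/-- The lifting `X_⊥`. -/
abbrev lift (X : WQbs.{u}) : WQbs.{u} where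
  carrier := WithBot X
  Random := liftRandom X
  random_const y := by
    cases y with
    | bot => exact bot_mem_liftRandom
    | coe x => exact ⟨Set.univ, MeasurableSet.univ, fun r hr => absurd trivial hr,
        fun _ => ⟨fun _ => x, X.random_const x, fun _ _ => rfl⟩⟩
  random_comp β h f hf := by
    obtain ⟨B, hB, h₁, h₂⟩ := h
    refine ⟨f ⁻¹' B, hf hB, fun r hr => h₁ _ hr, fun ⟨r, hr⟩ => ?_⟩
    obtain ⟨α, hα, h⟩ := h₂ ⟨_, hr⟩
    exact ⟨_, X.random_comp α hα f hf, fun r hr => h _ hr⟩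
  random_split := liftRandom_split
  random_ωSup := liftRandom_ωSup

end Lifting

section Powerdomain

variable {X : WQbs.{u}}

/-- The extension of a weighting function to `X_⊥` by `0`. -/
def weigh (w : Hom X weight) : WithBot X → ℝ≥0∞ := WithBot.recBotCoe 0 w

/-- The Schwartz distributions `J X`, i.e. the double exponential into the weights. -/
abbrev J (X : WQbs.{u}) : WQbs.{u} := exp (exp X weight) weight

/-- The randomisations `R X`, i.e. partial morphisms from `ℝ` to `X`. -/
abbrev R (X : WQbs.{u}) : WQbs.{u} := exp real (lift X)

theorem measurable_weigh {f : ℝ → Hom X weight} (hf : f ∈ expRandom X weight)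
    {β : ℝ → WithBot X} (hβ : β ∈ liftRandom X) : Measurable fun r => weigh (f r) (β r) := by
  classical
  obtain ⟨B, hB, h₁, h₂⟩ := hβ
  obtain rfl | hne := B.eq_empty_or_nonempty
  · have : (fun r => weigh (f r) (β r)) = fun _ => 0 := by
      funext r
      rw [h₁ r (by simp)]
      rfl
    rw [this]
    exact measurable_const
  · obtain ⟨α, hα, h⟩ := h₂ hne
    have : (fun r => weigh (f r) (β r)) = B.indicator fun r => f r (α r) := by
      funext r
      by_cases hr : r ∈ B
      · rw [Set.indicator_of_mem hr, h r hr]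
        rfl
      · rw [Set.indicator_of_notMem hr, h₁ r hr]
        rfl
    rw [this]
    exact Measurable.indicator ((mem_expRandom_iff f).1 hf _ measurable_id α hα) hB

theorem measurable_expect {f : ℝ → Hom X weight} (hf : f ∈ expRandom X weight)
    {γ : ℝ → Hom real (lift X)} (hγ : γ ∈ expRandom real (lift X)) :
    Measurable fun r => ∫⁻ s : ℝ, weigh (f r) (γ r s) := by
  let e : ℝ ≃ᵐ ℝ × ℝ := PolishSpace.measurableEquivOfNotCountable
    (by simp) (by simp only [not_countable_iff]; infer_instance)
  have h : Measurable fun p : ℝ × ℝ => weigh (f p.1) (γ p.1 p.2) := by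
    rw [← e.measurable_comp_iff]
    exact measurable_weigh ((exp X weight).random_comp f hf _ (measurable_fst.comp e.measurable))
      ((mem_expRandom_iff γ).1 hγ _ (measurable_fst.comp e.measurable) _
        (measurable_snd.comp e.measurable))
  exact h.lintegral_prod_right'

theorem weigh_mono {w w' : Hom X weight} (h : w ≤ w') (y : WithBot X) : weigh w y ≤ weigh w' y := by
  cases y with
  | bot => exact le_rfl
  | coe x => exact Hom.le_def.1 h x

theorem weigh_ωSup (c : Chain (Hom X weight)) (y : WithBot X) :
    weigh (ωSup c) y = ⨆ n, weigh (c n) y := by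
  cases y with
  | bot => exact (iSup_const (a := (0 : ℝ≥0∞))).symm
  | coe x => rfl

theorem measurable_weigh_apply (w : Hom X weight) (α : Hom real (lift X)) :
    Measurable fun r : ℝ => weigh w (α r) :=
  measurable_weigh ((exp X weight).random_const w) (α.random (fun r => r) measurable_id)

/-- The expectation operator `E_α [w] = ∫_{Dom α} w (α r) dr` of a randomisation `α`, where
the integrand is extended by `0` outside of `Dom α`. -/
def expectation (α : R X) : J X where
  toFun w := ∫⁻ r : ℝ, weigh w (Hom.toFun α r)
  cont := by
    refine ωScottContinuous.of_monotone_map_ωSup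
      ⟨fun w w' h => lintegral_mono fun r => weigh_mono h _, fun c => ?_⟩
    change ∫⁻ r : ℝ, weigh (ωSup c) (Hom.toFun α r) = ⨆ n, ∫⁻ r : ℝ, weigh (c n) (Hom.toFun α r)
    simp only [weigh_ωSup]
    exact lintegral_iSup (fun n => measurable_weigh_apply (c n) α)
      fun m n hmn r => weigh_mono (c.monotone hmn) _
  random _ hf := measurable_expect hf ((R X).random_const α)

/-- The closure of a subset of an `ω`-cpo under suprema of `ω`-chains. -/
inductive LubClosure {P : Type u} [OmegaCompletePartialOrder P] (S : Set P) : P → Prop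
  | base (p : P) : p ∈ S → LubClosure S p
  | lub (c : Chain P) : (∀ n, LubClosure S (c n)) → LubClosure S (ωSup c)

/-- The randomisable expectation operators. -/
def S (X : WQbs.{u}) : Set (J X) := Set.range expectation

/-- The randomisable random operators. -/
def randomS (X : WQbs.{u}) : Set (ℝ → J X) :=
  (fun γ r => expectation (γ r)) '' (R X).Random

theorem LubClosure.map {P : Type u} {Q : Type v} [OmegaCompletePartialOrder P]
    [OmegaCompletePartialOrder Q] {A : Set P} {B : Set Q} {f : P → Q} (hf : ωScottContinuous f)
    (h : ∀ p ∈ A, LubClosure B (f p)) {p : P} (hp : LubClosure A p) : LubClosure B (f p) := by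
  induction hp with
  | base p hp => exact h p hp
  | lub c _ ih =>
    rw [hf.map_ωSup]
    exact .lub _ ih

theorem lubClosure_const {μ : J X} (h : LubClosure (S X) μ) :
    LubClosure (randomS X) fun _ => μ := by
  refine h.map (f := fun μ _ => μ) (.of_apply₂ fun _ => .id) ?_
  rintro _ ⟨α, rfl⟩
  exact .base _ ⟨fun _ => α, (R X).random_const α, rfl⟩

theorem lubClosure_comp {β : ℝ → J X} (h : LubClosure (randomS X) β) {f : ℝ → ℝ}
    (hf : Measurable f) : LubClosure (randomS X) fun r => β (f r) := by
  refine h.map (f := fun β r => β (f r)) (.of_apply₂ fun r => .apply (f r)) ?_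
  rintro _ ⟨γ, hγ, rfl⟩
  exact .base _ ⟨_, (R X).random_comp γ hγ f hf, rfl⟩

open Classical in
theorem lubClosure_ite {B : Set ℝ} (hB : MeasurableSet B) {α β : ℝ → J X}
    (hα : LubClosure (randomS X) α) (hβ : LubClosure (randomS X) β) :
    LubClosure (randomS X) fun r => if r ∈ B then α r else β r := by
  refine hα.map (f := fun α r => if r ∈ B then α r else β r) (.of_apply₂ fun r => ?_) ?_
  · by_cases hr : r ∈ B
    · simpa only [hr, if_true] using .apply r
    · simpa only [hr, if_false] using .const
  intro α hα
  refine hβ.map (f := fun β r => if r ∈ B then α r else β r) (.of_apply₂ fun r => ?_) ?_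
  · by_cases hr : r ∈ B
    · simpa only [hr, if_true] using .const
    · simpa only [hr, if_false] using .apply r
  rintro _ ⟨δ, hδ, rfl⟩
  obtain ⟨γ, hγ, rfl⟩ := hα
  refine .base _ ⟨fun r => if r ∈ B then γ r else δ r,
    random_ite (R X) hB hγ hδ _ (fun r hr => if_pos hr) fun r hr => if_neg hr, ?_⟩
  funext r
  dsimp only
  split_ifs <;> rfl

/-- The nowhere defined randomisation. -/
def emptyRandomisation (X : WQbs.{u}) : R X :=
  ⟨fun _ => ⊥, ωScottContinuous.const, fun _ _ => bot_mem_liftRandom⟩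

theorem expectation_empty_le (μ : J X) : expectation (emptyRandomisation X) ≤ μ := by
  refine Hom.le_def.2 fun w => ?_
  have : expectation (emptyRandomisation X) w = ∫⁻ _ : ℝ, 0 := rfl
  rw [this, lintegral_zero]
  exact zero_le

theorem lubClosure_split {N : ℝ → ℕ} (hN : Measurable N) {α : ℕ → ℝ → J X}
    (hα : ∀ n, LubClosure (randomS X) (α n)) :
    LubClosure (randomS X) fun r => α (N r) r := by
  classical
  let d : Chain (ℝ → J X) :=
    ⟨⟨fun n r => if N r < n then α (N r) r else expectation (emptyRandomisation X), by
      intro m n hmn r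
      dsimp only
      split_ifs with h₁ h₂
      · exact le_rfl
      · exact absurd (h₁.trans_le hmn) h₂
      · exact expectation_empty_le _
      · exact le_rfl⟩⟩
  have hd : ∀ n, LubClosure (randomS X) (d n) := by
    intro n
    induction n with
    | zero =>
      convert lubClosure_const (.base _ ⟨emptyRandomisation X, rfl⟩) using 1
      funext r
      exact if_neg (c := N r < 0) (t := α (N r) r) (Nat.not_lt_zero _)
    | succ n ih =>
      convert lubClosure_ite (hN (measurableSet_singleton n)) (hα n) ih using 1
      funext r
      by_cases h : N r = n
      · rw [if_pos (show r ∈ N ⁻¹' {n} from h)]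
        change (if N r < n + 1 then _ else _) = _
        rw [if_pos (by omega), h]
      · rw [if_neg (show r ∉ N ⁻¹' {n} from h)]
        change (if N r < n + 1 then _ else _) = if N r < n then _ else _
        have : N r < n + 1 ↔ N r < n := by omega
        simp only [this]
  convert LubClosure.lub d hd using 1
  funext r
  refine le_antisymm (le_ωSup_of_le (c := d.map (Pi.evalOrderHom r)) (N r + 1) ?_)
    (ωSup_le (d.map (Pi.evalOrderHom r)) _ fun n => ?_)
  · change _ ≤ if N r < N r + 1 then _ else _
    simp
  · change (if N r < n then _ else _) ≤ _
    split_ifs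
    · exact le_rfl
    · exact expectation_empty_le _

instance (X : WQbs.{u}) : OmegaCompletePartialOrder {μ : J X // LubClosure (S X) μ} :=
  OmegaCompletePartialOrder.subtype _ fun c hc => .lub c fun n => hc _ ⟨n, rfl⟩

/-- The statistical powerdomain `T X`: its elements are the `ω`-lub-closure of the randomisable
operators, its random elements are the `ω`-lub-closure of the randomisable random operators. -/
def T (X : WQbs.{u}) : WQbs.{u} where
  carrier := {μ : J X // LubClosure (S X) μ}
  Random := {β | LubClosure (randomS X) fun r => (β r).1}
  random_const μ := lubClosure_const μ.2
  random_comp _ h _ hf := lubClosure_comp h hf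
  random_split _ hN _ h := lubClosure_split hN h
  random_ωSup c h := .lub (c.map ⟨fun β r => (β r).1, fun _ _ h r => h r⟩) h

/-- The expectation `μ[w]` of a weighting function, as a morphism in `μ`. -/
def expect (w : Hom X weight) : Hom (T X) weight where
  toFun μ := μ.1 w
  cont := ωScottContinuous.of_monotone_map_ωSup ⟨fun _ _ h => Hom.le_def.1 h w, fun _ => rfl⟩
  random β hβ := by
    have key : ∀ β : ℝ → J X, LubClosure (randomS X) β → Measurable fun r => β r w := by
      intro β hβ
      induction hβ with
      | base p hp =>
        obtain ⟨γ, hγ, rfl⟩ := hp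
        exact measurable_expect ((exp X weight).random_const w) hγ
      | lub c _ ih => exact Measurable.iSup ih
    exact key _ hβ

theorem Hom.map_ωSup_weight (f : Hom X weight) (c : Chain X) : f (ωSup c) = ⨆ n, f (c n) :=
  f.cont.map_ωSup c

/-- Weighting functions are added and scaled pointwise. -/
instance : Zero (Hom X weight) :=
  ⟨⟨fun _ => 0, ωScottContinuous.const, fun _ _ => measurable_const⟩⟩

instance : Add (Hom X weight) where
  add f g :=
    { toFun := fun x => f x + g x
      cont := ωScottContinuous.of_monotone_map_ωSup
        ⟨fun x y h => add_le_add (f.cont.monotone h) (g.cont.monotone h), fun c => by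
          rw [f.map_ωSup_weight, g.map_ωSup_weight]
          exact ENNReal.iSup_add_iSup_of_monotone (fun _ _ h => f.cont.monotone (c.monotone h))
            (fun _ _ h => g.cont.monotone (c.monotone h))⟩
      random := fun α hα => Measurable.add (f.random α hα) (g.random α hα) }

instance : SMul ℝ≥0∞ (Hom X weight) where
  smul a f :=
    { toFun := fun x => a * f x
      cont := ωScottContinuous.of_monotone_map_ωSup
        ⟨fun x y h => mul_le_mul_right (f.cont.monotone h) a, fun c => by
          rw [f.map_ωSup_weight]
          exact ENNReal.mul_iSup a _⟩
      random := fun α hα => Measurable.const_mul (f.random α hα) a }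

instance : AddCommMonoid (Hom X weight) where
  add_assoc f g h := Hom.ext fun x => add_assoc (f x) (g x) (h x)
  zero_add f := Hom.ext fun x => zero_add (f x)
  add_zero f := Hom.ext fun x => add_zero (f x)
  add_comm f g := Hom.ext fun x => add_comm (f x) (g x)
  nsmul := nsmulRec

instance : Module ℝ≥0∞ (Hom X weight) where
  one_smul f := Hom.ext fun x => one_mul (f x)
  mul_smul a b f := Hom.ext fun x => mul_assoc a b (f x)
  smul_zero a := Hom.ext fun _ => mul_zero a
  smul_add a f g := Hom.ext fun x => mul_add a (f x) (g x)
  add_smul a b f := Hom.ext fun x => add_mul a b (f x)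
  zero_smul f := Hom.ext fun x => zero_mul (f x)

end Powerdomain

instance : Category WQbs.{u} where
  Hom X Y := Hom X Y
  id := Hom.id
  comp f g := g.comp f

instance : ConcreteCategory WQbs.{u} (fun X Y => Hom X Y) where
  hom f := f
  ofHom f := f

instance : CartesianMonoidalCategory WQbs.{u} :=
  .ofChosenFiniteProducts
    ⟨asEmptyCone unit, IsTerminal.ofUniqueHom
      (fun _ => ⟨fun _ => PUnit.unit, ωScottContinuous.const, fun _ _ => trivial⟩)
      (fun _ _ => rfl)⟩
    fun X Y => ⟨BinaryFan.mk (P := prod X Y) fstHom sndHom,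
      BinaryFan.IsLimit.mk _ (fun f g => pairHom f g) (fun _ _ => rfl) (fun _ _ => rfl)
        (by rintro T f g m rfl rfl; rfl)⟩

/-- The category is Cartesian closed, with `exp X Y` as exponential. -/
instance : MonoidalClosed WQbs.{u} where
  closed X :=
    { rightAdj :=
        { obj := fun Y => exp X Y
          map := fun {Y Z} g => curryHom (Hom.comp g evalHom)
          map_id := fun _ => rfl
          map_comp := fun _ _ => rfl }
      adj :=
        { unit := { app := fun Z => curryHom (Hom.id (prod X Z)) }
          counit := { app := fun Y => evalHom } } }

end WQbs

section MeasureCategory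

variable {C : Type v} [Category.{w} C] [CartesianMonoidalCategory C] [MonoidalClosed C]

/-- A strong monad structure with object map `T` on a Cartesian closed category: a unit and an
internal bind `T X × (T Y) ^ X ⟶ T Y`. -/
structure StrongMonadStructure (T : C → C) where
  ret (X : C) : X ⟶ T X
  bind (X Y : C) : T X ⊗ (ihom X).obj (T Y) ⟶ T Y

namespace StrongMonadStructure

variable {T : C → C} (M : StrongMonadStructure T)

/-- The term `Γ ⊢ a >>= λ x. k` of the internal language, for `Γ ⊢ a : T X` and
`x : X, Γ ⊢ k : T Y`. -/
def bindIn {Γ X Y : C} (a : Γ ⟶ T X) (k : X ⊗ Γ ⟶ T Y) : Γ ⟶ T Y :=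
  lift a (MonoidalClosed.curry k) ≫ M.bind X Y

/-- The monad laws, as equations of the internal language in an arbitrary context `Γ`. -/
structure IsStrongMonad : Prop where
  /-- `(return x >>= f) = f x` -/
  ret_bind {Γ X Y : C} (x : Γ ⟶ X) (f : Γ ⟶ (ihom X).obj (T Y)) :
    lift (x ≫ M.ret X) f ≫ M.bind X Y = lift x f ≫ (ihom.ev X).app (T Y)
  /-- `(a >>= λ x. return x) = a` -/
  bind_ret {Γ X : C} (a : Γ ⟶ T X) : M.bindIn a (fst X Γ ≫ M.ret X) = a
  /-- `((a >>= f) >>= g) = (a >>= λ x. (f x >>= g))` -/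
  bind_assoc {Γ X Y Z : C} (a : Γ ⟶ T X) (f : Γ ⟶ (ihom X).obj (T Y))
    (g : Γ ⟶ (ihom Y).obj (T Z)) :
    lift (lift a f ≫ M.bind X Y) g ≫ M.bind Y Z =
      M.bindIn a (lift (lift (fst X Γ) (snd X Γ ≫ f) ≫ (ihom.ev X).app (T Y)) (snd X Γ ≫ g) ≫
        M.bind Y Z)

/-- Commutativity: `(a >>= λ x. b >>= λ y. return (x, y)) = (b >>= λ y. a >>= λ x. return (x, y))`
in every context `Γ`. -/
def IsCommutative : Prop :=
  ∀ (Γ X Y : C) (a : Γ ⟶ T X) (b : Γ ⟶ T Y),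
    M.bindIn a (M.bindIn (snd X Γ ≫ b)
        (lift (snd Y (X ⊗ Γ) ≫ fst X Γ) (fst Y (X ⊗ Γ)) ≫ M.ret (X ⊗ Y))) =
      M.bindIn b (M.bindIn (snd Y Γ ≫ a)
        (lift (fst X (Y ⊗ Γ)) (snd X (Y ⊗ Γ) ≫ fst Y Γ) ≫ M.ret (X ⊗ Y)))

/-- The Kleisli extension `a ↦ (a >>= f)` of `f : X ⟶ T Y`. -/
def ext {X Y : C} (f : X ⟶ T Y) : T X ⟶ T Y := M.bindIn (𝟙 (T X)) (fst X (T X) ≫ f)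

/-- The action of `T` on morphisms. -/
def map {X Y : C} (f : X ⟶ Y) : T X ⟶ T Y := M.ext (f ≫ M.ret Y)

/-- The zero measure on `X`, as a global element: the image of the element of `T 0 ≅ 1`. -/
def zero [HasInitial C] [IsIso (toUnit (T (⊥_ C)))] (X : C) : 𝟙_ C ⟶ T X :=
  inv (toUnit (T (⊥_ C))) ≫ M.map (initial.to X)

open Classical in
/-- The Kleisli arrow `X i ⟶ T (X j)` that is the unit if `i = j` and zero otherwise. -/
def delta [HasInitial C] [IsIso (toUnit (T (⊥_ C)))] (X : ℕ → C) (i j : ℕ) : X i ⟶ T (X j) :=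
  if h : i = j then eqToHom (congrArg X h) ≫ M.ret (X j) else toUnit (X i) ≫ M.zero (X j)

/-- The canonical morphism `T (∑ i, X i) ⟶ ∏ j, T (X j)`. -/
def toPi [HasCountableLimits C] [HasCountableCoproducts C] [IsIso (toUnit (T (⊥_ C)))]
    (X : ℕ → C) : T (∐ X) ⟶ ∏ᶜ fun j => T (X j) :=
  Pi.lift fun j => M.ext (Sigma.desc fun i => M.delta X i j)

/-- `M` makes the Cartesian closed category `C` into a measure category: `C` has countable limits
and coproducts, `M` is a commutative strong monad, and the canonical morphisms `T 0 ⟶ 1` and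
`T (∑ i, X i) ⟶ ∏ j, T (X j)` are invertible. -/
structure IsMeasureCategory : Prop where
  hasCountableLimits : HasCountableLimits C
  hasCountableCoproducts : HasCountableCoproducts C
  isStrongMonad : M.IsStrongMonad
  isCommutative : M.IsCommutative
  isIso_toUnit : IsIso (toUnit (T (⊥_ C)))
  isIso_toPi (X : ℕ → C) : IsIso (M.toPi X)

variable {M}

/-- Countable addition of scalars: `∏ n, T 1 ≅ T (∑ n, 1) ⟶ T 1`, applied to a sequence of scalars
in a context `Γ`. -/
def scalarSum (h : M.IsMeasureCategory) {Γ : C} (a : ℕ → (Γ ⟶ T (𝟙_ C))) : Γ ⟶ T (𝟙_ C) :=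
  haveI := h.hasCountableLimits
  haveI := h.hasCountableCoproducts
  haveI := h.isIso_toUnit
  haveI := h.isIso_toPi
  Pi.lift a ≫ inv (M.toPi fun _ => 𝟙_ C) ≫ M.map (Sigma.desc fun _ => 𝟙 (𝟙_ C))

/-- The zero scalar. -/
def scalarZero (h : M.IsMeasureCategory) (Γ : C) : Γ ⟶ T (𝟙_ C) :=
  haveI := h.hasCountableCoproducts
  haveI := h.isIso_toUnit
  toUnit Γ ≫ M.zero (𝟙_ C)

/-- Binary addition of scalars: `a + b + 0 + 0 + ⋯`. -/
def scalarAdd (h : M.IsMeasureCategory) {Γ : C} (a b : Γ ⟶ T (𝟙_ C)) : Γ ⟶ T (𝟙_ C) :=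
  scalarSum h fun n => match n with
    | 0 => a
    | 1 => b
    | _ => scalarZero h Γ

variable (M)

/-- The unit scalar. -/
def scalarOne (Γ : C) : Γ ⟶ T (𝟙_ C) := toUnit Γ ≫ M.ret (𝟙_ C)

/-- Multiplication of scalars: `a >>= λ _. b`. -/
def scalarMul {Γ : C} (a b : Γ ⟶ T (𝟙_ C)) : Γ ⟶ T (𝟙_ C) := M.bindIn a (snd (𝟙_ C) Γ ≫ b)

end StrongMonadStructure

end MeasureCategory

end

/-! An element of `T X` is determined by its expectations (`T_ext`), and unit and bind act on these
as in the continuation monad `J`. The monad laws are then nearly formal. The real work is to show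
that `T` is closed under the operations, that iterated expectations commute, and that measures on a
countable coproduct decompose. The closure and commutation arguments treat randomisable operators
first and then pass to lubs of chains by Scott continuity and monotone convergence.

Closure rests on one fact: the Lebesgue integral over the line of a random family in `T Y` is again
in `T Y` (`integral`). For a family of randomisations this is an iterated integral, hence an
integral over the plane; the plane is a measure-preserving image of the line
(`exists_planeFilling`), so the result is the expectation of a single randomisation. Bind follows,
because binding `E_α` with `f` is the integral of `f (α s)` over `s`, with the zero element off the
domain of `α` (`lubClosure_bindJ`). Countable sums are integrals of families that are constant on
unit intervals (`sumHom`). The point mass at `x` with weight `t` is randomised by the constant `x`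
on an interval of length `t` (`dirac`); the unit is the case `t = 1`.

Commutativity is Tonelli's theorem (`expectation_comm`, `lubClosure_comm`). For coproducts,
expectations are linear and Scott-continuous, hence countably additive (`expect_tsum`). A weight on
a coproduct is the sum of its restrictions to the summands, so an element is the sum of its
components, and summing a family inverts the comparison morphism. A weight on the one-point space is
a multiple of the constant `1`, so a scalar is determined by its total mass, and every mass in
`[0,∞]` occurs. -/

noncomputable section

/-! ### Lebesgue measure on the line and on the plane. -/

/-- A Borel isomorphism between the line and the plane. -/
def realPlane : ℝ ≃ᵐ ℝ × ℝ :=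
  PolishSpace.measurableEquivOfNotCountable (by simp)
    (by simp only [not_countable_iff]; infer_instance)

theorem lintegral_unitInterval (g : ℝ → ℝ≥0∞) :
    ∫⁻ t : unitInterval, g t = ∫⁻ t in Set.Ico (0 : ℝ) 1, g t := by
  rw [setLIntegral_congr (Ico_ae_eq_Icc (μ := volume) (a := (0 : ℝ)) (b := 1))]
  exact lintegral_subtype_comap measurableSet_Icc g

theorem setLIntegral_Ico_intCast (g : ℝ → ℝ≥0∞) (k : ℤ) :
    ∫⁻ t in Set.Ico (k : ℝ) (k + 1), g t = ∫⁻ t in Set.Ico (0 : ℝ) 1, g (t + k) := by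
  have := (measurePreserving_add_right (volume : Measure ℝ) (k : ℝ)).setLIntegral_comp_preimage_emb
    (MeasurableEquiv.addRight (k : ℝ)).measurableEmbedding g (Set.Ico (k : ℝ) (k + 1))
  rw [← this]
  congr 2
  simp

/-- The unit intervals with integer endpoints tile the line, and translation moves each of them to
`[0, 1)`. This serves both to glue the plane-filling map and to read a sum as an integral. -/
theorem lintegral_eq_tsum_Ico (g : ℝ → ℝ≥0∞) :
    ∫⁻ t, g t = ∑' k : ℤ, ∫⁻ t in Set.Ico (0 : ℝ) 1, g (t + k) := by
  rw [← setLIntegral_univ, ← iUnion_Ico_intCast ℝ, lintegral_iUnion (fun _ => measurableSet_Ico)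
    (Set.pairwise_disjoint_Ico_intCast ℝ)]
  exact tsum_congr fun k => setLIntegral_Ico_intCast g k

/-- The cell of the integer grid in the plane with a given lower left corner. -/
def gridCell (p : ℤ × ℤ) : Set (ℝ × ℝ) :=
  Set.Ico (p.1 : ℝ) (p.1 + 1) ×ˢ Set.Ico (p.2 : ℝ) (p.2 + 1)

theorem mem_gridCell {p : ℤ × ℤ} {x : ℝ × ℝ} : x ∈ gridCell p ↔ (⌊x.1⌋, ⌊x.2⌋) = p := by
  rw [gridCell, Set.mem_prod, Set.mem_Ico, Set.mem_Ico, ← Int.floor_eq_iff, ← Int.floor_eq_iff,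
    Prod.ext_iff]

theorem measurableSet_gridCell (p : ℤ × ℤ) : MeasurableSet (gridCell p) :=
  measurableSet_Ico.prod measurableSet_Ico

theorem isProbabilityMeasure_gridCell (p : ℤ × ℤ) :
    IsProbabilityMeasure ((volume : Measure (ℝ × ℝ)).restrict (gridCell p)) := by
  constructor
  rw [Measure.restrict_apply_univ, gridCell, Measure.volume_eq_prod, Measure.prod_prod]
  simp

theorem lintegral_eq_tsum_gridCell (g : ℝ × ℝ → ℝ≥0∞) :
    ∫⁻ x, g x = ∑' p : ℤ × ℤ, ∫⁻ x in gridCell p, g x := by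
  rw [← lintegral_iUnion measurableSet_gridCell, ← setLIntegral_univ]
  · congr 2
    symm
    exact Set.eq_univ_of_forall fun x => Set.mem_iUnion.2 ⟨_, mem_gridCell.2 rfl⟩
  · intro p q hpq
    exact Set.disjoint_left.2 fun x hp hq =>
      hpq ((mem_gridCell.1 hp).symm.trans (mem_gridCell.1 hq))

/-- Lebesgue measure on the plane is the image of Lebesgue measure on the line. -/
theorem exists_planeFilling : ∃ e : ℝ → ℝ × ℝ, Measurable e ∧
    ∀ g : ℝ × ℝ → ℝ≥0∞, Measurable g → ∫⁻ t, g (e t) = ∫⁻ x, g x := by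
  -- Each cell has area `1`, so Lebesgue measure on it is a probability law on a standard Borel
  -- space, hence an image of the uniform law on the unit interval.
  have hf : ∀ p : ℤ × ℤ, ∃ f : unitInterval → ℝ × ℝ, Measurable f ∧
      volume.map f = (volume : Measure (ℝ × ℝ)).restrict (gridCell p) := fun p =>
    haveI := isProbabilityMeasure_gridCell p
    Measure.exists_measurable_map_eq _
  choose f hfm hf using hf
  obtain ⟨σ⟩ : Nonempty (ℤ ≃ ℤ × ℤ) := ⟨(nonempty_denumerable ℤ).some.eqv.trans
    (nonempty_denumerable (ℤ × ℤ)).some.eqv.symm⟩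
  have hproj : Measurable (Set.projIcc (0 : ℝ) 1 zero_le_one) := continuous_projIcc.measurable
  -- The integer part of `t` selects a cell and the fractional part a point in it; `Set.projIcc`
  -- only changes the type, since fractional parts already lie in the unit interval.
  refine ⟨fun t => f (σ ⌊t⌋) (Set.projIcc (0 : ℝ) 1 zero_le_one (Int.fract t)), ?_, ?_⟩
  · have h : Measurable fun q : ℤ × ℝ => f (σ q.1) (Set.projIcc (0 : ℝ) 1 zero_le_one q.2) :=
      measurable_from_prod_countable_right fun k => (hfm (σ k)).comp hproj
    exact h.comp (Int.measurable_floor.prodMk measurable_fract)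
  · intro g hg
    rw [lintegral_eq_tsum_gridCell, lintegral_eq_tsum_Ico, ← σ.tsum_eq]
    refine tsum_congr fun k => ?_
    rw [← hf, lintegral_map hg (hfm _)]
    have := lintegral_unitInterval fun t => g (f (σ k) (Set.projIcc (0 : ℝ) 1 zero_le_one t))
    simp only [Set.projIcc_val] at this
    rw [this]
    refine setLIntegral_congr_fun measurableSet_Ico fun t ht => ?_
    have h0 : ⌊t + (k : ℝ)⌋ = k := by
      rw [Int.floor_add_intCast, Int.floor_eq_zero_iff.2 ht, zero_add]
    have h1 : Int.fract (t + (k : ℝ)) = t := by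
      rw [Int.fract_add_intCast, Int.fract_eq_self.2 ht]
    simp only [h0, h1]

namespace WQbs

/-! ### Morphisms out of the line, and operations on weights. -/

theorem ωScottContinuous_discr {α : Type u} {β : Type v} [OmegaCompletePartialOrder β]
    (f : Discr α → β) : ωScottContinuous f := by
  have hmono : Monotone f := fun a b (h : a = b) => h ▸ le_rfl
  refine ωScottContinuous.of_monotone_map_ωSup ⟨hmono, fun c => ?_⟩
  refine le_antisymm (le_ωSup_of_le (c := c.map ⟨f, hmono⟩) 0 le_rfl) (ωSup_le _ _ fun n => ?_)
  exact hmono (show c n = c 0 from (c.monotone (Nat.zero_le n) : c 0 = c n).symm)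

/-- A random element is the same as a morphism out of the real line. -/
def ofRandom {Y : WQbs.{v}} (f : ℝ → Y) (hf : f ∈ Y.Random) : Hom real Y :=
  ⟨f, ωScottContinuous_discr f, fun α hα => Y.random_comp f hf α hα⟩

/-- Post-composition as a morphism of exponentials. -/
def postcomp (Z : WQbs.{w}) {X : WQbs.{u}} {Y : WQbs.{v}} (g : Hom X Y) :
    Hom (exp Z X) (exp Z Y) :=
  curryHom (g.comp evalHom)

section Weight

theorem iSup_mul_iSup_of_monotone {f g : ℕ → ℝ≥0∞} (hf : Monotone f) (hg : Monotone g) :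
    (⨆ n, f n) * ⨆ n, g n = ⨆ n, f n * g n := by
  refine le_antisymm ?_ (iSup_le fun n => mul_le_mul' (le_iSup f n) (le_iSup g n))
  rw [ENNReal.iSup_mul]
  refine iSup_le fun m => ?_
  rw [ENNReal.mul_iSup]
  exact iSup_le fun n => le_iSup_of_le (max m n)
    (mul_le_mul' (hf (le_max_left m n)) (hg (le_max_right m n)))

/-- The multiplication of weights. -/
def mulHom : Hom (prod weight weight) weight where
  toFun p := p.1 * p.2
  cont := ωScottContinuous.of_monotone_map_ωSup
    ⟨fun _ _ h => mul_le_mul' h.1 h.2, fun c => iSup_mul_iSup_of_monotone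
      (fun _ _ h => (c.monotone h).1) fun _ _ h => (c.monotone h).2⟩
  random _ hγ := Measurable.mul hγ.1 hγ.2

/-- Random elements of an exponential are tested only along Borel curves. The Borel isomorphism
`realPlane` is a curve through all points of the plane, so testing along it gives joint
measurability. -/
theorem measurable_uncurry {f : ℝ → Hom real weight} (hf : f ∈ expRandom real weight) :
    Measurable fun p : ℝ × ℝ => (f p.1 p.2 : ℝ≥0∞) := by
  rw [← realPlane.measurable_comp_iff]
  exact (mem_expRandom_iff f).1 hf _ (measurable_fst.comp realPlane.measurable) _
    (measurable_snd.comp realPlane.measurable)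

/-- Lebesgue integration of random weights. -/
def lintegralHom : Hom (exp real weight) weight where
  toFun f := ∫⁻ s : ℝ, Hom.toFun f s
  cont := ωScottContinuous.of_monotone_map_ωSup
    ⟨fun _ _ h => lintegral_mono fun s => Hom.le_def.1 h s, fun c =>
      lintegral_iSup (fun n => (c n).random (fun s => s) measurable_id)
        fun _ _ h s => Hom.le_def.1 (c.monotone h) s⟩
  random _ hf := (measurable_uncurry hf).lintegral_prod_right'

/-- The domain of the randomisation of a point mass of weight `t`, with `t = ∞` included. The
condition `0 < s` is needed because `ENNReal.ofReal` sends the whole negative half-line to `0`. -/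
theorem volume_ofReal_lt (t : ℝ≥0∞) : volume {s : ℝ | 0 < s ∧ ENNReal.ofReal s < t} = t := by
  induction t with
  | top =>
    have : {s : ℝ | 0 < s ∧ ENNReal.ofReal s < ⊤} = Set.Ioi 0 := by
      ext s
      simp
    rw [this, Real.volume_Ioi]
  | coe t =>
    have : {s : ℝ | 0 < s ∧ ENNReal.ofReal s < t} = Set.Ioo 0 (t : ℝ) := by
      ext s
      simp only [Set.mem_ofPred_eq, Set.mem_Ioo, and_congr_right_iff]
      intro hs
      rw [← ENNReal.ofReal_coe_nnreal, ENNReal.ofReal_lt_ofReal_iff_of_nonneg hs.le]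
    rw [this, Real.volume_Ioo, sub_zero, ENNReal.ofReal_coe_nnreal]

end Weight

/-! ### Expectations: extensionality, linearity and countable additivity. -/

section Expectation

variable {X : WQbs.{u}} {Y : WQbs.{v}} {P : WQbs.{w}}

theorem random_of_lubClosure {β : ℝ → J X} (h : LubClosure (randomS X) β) : β ∈ (J X).Random := by
  induction h with
  | base p hp =>
    obtain ⟨γ, hγ, rfl⟩ := hp
    exact (mem_expRandom_iff _).2 fun ρ hρ ξ hξ =>
      measurable_expect hξ ((R X).random_comp γ hγ ρ hρ)
  | lub c _ ih => exact (J X).random_ωSup c ih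

theorem lubClosure_apply {β : ℝ → J X} (h : LubClosure (randomS X) β) (r : ℝ) :
    LubClosure (S X) (β r) := by
  refine h.map (f := fun β => β r) (.apply r) ?_
  rintro _ ⟨γ, hγ, rfl⟩
  exact .base _ ⟨γ r, rfl⟩

/-- The inclusion of the statistical powerdomain into the double exponential. -/
def incl (X : WQbs.{u}) : Hom (T X) (J X) where
  toFun μ := μ.1
  cont := ωScottContinuous.of_monotone_map_ωSup ⟨fun _ _ h => h, fun _ => rfl⟩
  random _ h := random_of_lubClosure h

theorem T_ext {μ ν : T X} (h : ∀ w : Hom X weight, expect w μ = expect w ν) : μ = ν :=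
  Subtype.ext (Hom.ext h)

/-- Corestriction of a morphism into `J X` to a morphism into `T X`. -/
def corestrict (F : Hom P (J X))
    (h : ∀ π ∈ P.Random, LubClosure (randomS X) fun r => F (π r)) : Hom P (T X) where
  toFun p := ⟨F p, lubClosure_apply (h (fun _ => p) (P.random_const p)) 0⟩
  cont := ωScottContinuous.of_monotone_map_ωSup
    ⟨fun _ _ h => F.cont.monotone h, fun c => Subtype.ext (F.cont.map_ωSup c)⟩
  random := h

theorem weigh_add (v w : Hom X weight) (y : WithBot X) :
    weigh (v + w) y = weigh v y + weigh w y := by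
  cases y with
  | bot => exact (zero_add (0 : ℝ≥0∞)).symm
  | coe x => rfl

theorem weigh_smul (c : ℝ≥0∞) (w : Hom X weight) (y : WithBot X) :
    weigh (c • w) y = c * weigh w y := by
  cases y with
  | bot => exact (mul_zero c).symm
  | coe x => rfl

/-- Linearity of the integral for randomisable operators. It survives lubs because addition and
scaling in `[0,∞]` commute with suprema of increasing sequences. -/
theorem expect_isLinearMap (μ : T X) :
    IsLinearMap ℝ≥0∞ fun w : Hom X weight => (expect w μ : ℝ≥0∞) := by
  obtain ⟨μ, hμ⟩ := μ
  change IsLinearMap ℝ≥0∞ fun w : Hom X weight => (μ w : ℝ≥0∞)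
  induction hμ with
  | base μ hμ =>
    obtain ⟨α, rfl⟩ := hμ
    constructor
    · intro v w
      exact (lintegral_congr fun r => weigh_add v w (α r)).trans
        (lintegral_add_left (measurable_weigh_apply v α) _)
    · intro c w
      exact (lintegral_congr fun r => weigh_smul c w (α r)).trans
        (lintegral_const_mul c (measurable_weigh_apply w α))
  | lub c _ ih =>
    have hsup : ∀ w, (ωSup c : J X) w = ⨆ n, c n w := fun _ => rfl
    constructor
    · intro v w
      simp only [hsup, (ih _).map_add]
      exact (ENNReal.iSup_add_iSup_of_monotone (fun _ _ h => Hom.le_def.1 (c.monotone h) v)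
        fun _ _ h => Hom.le_def.1 (c.monotone h) w).symm
    · intro a w
      simp only [hsup, (ih _).map_smul]
      exact (ENNReal.mul_iSup a _).symm

theorem expect_zero (μ : T X) : expect (0 : Hom X weight) μ = (0 : ℝ≥0∞) :=
  (expect_isLinearMap μ).map_zero

theorem expect_ωSup (μ : T X) (c : Chain (Hom X weight)) :
    expect (ωSup c) μ = ⨆ n, expect (c n) μ :=
  μ.1.cont.map_ωSup c

/-- Expectations are countably additive. -/
theorem expect_tsum (μ : T X) (v : ℕ → Hom X weight) (w : Hom X weight)
    (h : ∀ x, (w x : ℝ≥0∞) = ∑' n, (v n x : ℝ≥0∞)) :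
    (expect w μ : ℝ≥0∞) = ∑' n, (expect (v n) μ : ℝ≥0∞) := by
  let s : ℕ → Hom X weight := Nat.rec 0 fun n f => f + v n
  have hs : ∀ n x, (s n x : ℝ≥0∞) = ∑ i ∈ Finset.range n, (v i x : ℝ≥0∞) := by
    intro n x
    induction n with
    | zero => rfl
    | succ n ih =>
      rw [Finset.sum_range_succ, ← ih]
      rfl
  have hμ : ∀ n, (expect (s n) μ : ℝ≥0∞) = ∑ i ∈ Finset.range n, (expect (v i) μ : ℝ≥0∞) := by
    intro n
    induction n with
    | zero => exact expect_zero μ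
    | succ n ih =>
      rw [Finset.sum_range_succ, ← ih]
      exact (expect_isLinearMap μ).map_add _ _
  -- The partial sums form a chain with lub `w`, so Scott continuity of `μ` upgrades finite to
  -- countable additivity.
  let c : Chain (Hom X weight) := ⟨⟨s, monotone_nat_of_le_succ fun n =>
    Hom.le_def.2 fun x => le_self_add (a := (s n x : ℝ≥0∞)) (b := v n x)⟩⟩
  have hw : w = ωSup c := by
    refine Hom.ext fun x => ?_
    change (w x : ℝ≥0∞) = ⨆ n, s n x
    rw [h, ENNReal.tsum_eq_iSup_nat]
    exact iSup_congr fun n => (hs n x).symm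
  rw [hw, expect_ωSup, ENNReal.tsum_eq_iSup_nat]
  exact iSup_congr hμ

end Expectation

/-! ### Integrals and countable sums in the powerdomain. -/

section Integral

variable {X : WQbs.{u}} {Y : WQbs.{v}} {P : WQbs.{w}}

/-- Integration over the real line of families of operators. -/
def integralJ (Y : WQbs.{v}) : Hom (exp real (J Y)) (J Y) :=
  curryHom (lintegralHom.comp (curryHom (X := real) (Z := prod (exp Y weight) (exp real (J Y)))
    (evalHom.comp (pairHom (fstHom.comp sndHom)
      (evalHom.comp (pairHom fstHom (sndHom.comp sndHom)))))))

/-- A two-parameter family is encoded as the one-parameter family `β` reindexed by `κ`, since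
`LubClosure` is available only for functions of one real variable. The formula determines `g`
completely, so in the lub case the chosen functions automatically form a chain. -/
theorem exists_lubClosure_integral {β : ℝ → J Y} (h : LubClosure (randomS Y) β) {κ : ℝ × ℝ → ℝ}
    (hκ : Measurable κ) : ∃ g : ℝ → J Y, LubClosure (randomS Y) g ∧
      ∀ r (w : Hom Y weight), g r w = ∫⁻ s : ℝ, β (κ (r, s)) w := by
  induction h with
  | base β hβ =>
    obtain ⟨γ, hγ, rfl⟩ := hβ
    obtain ⟨e, he, hvol⟩ := exists_planeFilling
    have hγ' := (mem_expRandom_iff γ).1 hγ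
    -- The integration variable and the variable of the randomisation become the two coordinates of
    -- `e t`. Arbitrary `ρ` and `σ` are allowed so that the same fact makes each `δ r` a morphism
    -- and `δ` a random element.
    have hδ : ∀ ρ : ℝ → ℝ, Measurable ρ → ∀ σ : ℝ → ℝ, Measurable σ →
        (fun r => γ (κ (ρ r, (e (σ r)).1)) (e (σ r)).2) ∈ liftRandom Y := fun ρ hρ σ hσ =>
      hγ' _ (hκ.comp (hρ.prodMk (measurable_fst.comp (he.comp hσ)))) _
        (measurable_snd.comp (he.comp hσ))
    let δ : ℝ → Hom real (lift Y) := fun r =>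
      ofRandom (fun t => γ (κ (r, (e t).1)) (e t).2) (hδ _ measurable_const _ measurable_id)
    refine ⟨fun r => expectation (δ r), .base _ ⟨δ, (mem_expRandom_iff δ).2 hδ, rfl⟩, ?_⟩
    intro r w
    have hm : Measurable fun p : ℝ × ℝ => weigh w (γ (κ (r, p.1)) p.2) := by
      rw [← realPlane.measurable_comp_iff]
      exact measurable_weigh ((exp Y weight).random_const w)
        (hγ' _ (hκ.comp (measurable_const.prodMk (measurable_fst.comp realPlane.measurable))) _
          (measurable_snd.comp realPlane.measurable))
    refine (hvol _ hm).trans ?_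
    rw [Measure.volume_eq_prod, lintegral_prod _ hm.aemeasurable]
    rfl
  | lub c hc ih =>
    choose g hg hgw using ih
    let d : Chain (ℝ → J Y) := ⟨⟨g, fun m n hmn r => Hom.le_def.2 fun w => by
      rw [hgw, hgw]
      exact lintegral_mono fun s => Hom.le_def.1 (c.monotone hmn _) w⟩⟩
    refine ⟨ωSup d, .lub d hg, fun r w => ?_⟩
    have h1 : (ωSup d : ℝ → J Y) r w = ⨆ n, g n r w := rfl
    rw [h1]
    simp only [hgw]
    -- Monotone convergence.
    refine (lintegral_iSup (f := fun n s => c n (κ (r, s)) w) (fun n => ?_)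
      fun m n hmn s => Hom.le_def.1 (c.monotone hmn (κ (r, s))) w).symm
    exact (mem_expRandom_iff _).1 (random_of_lubClosure (hc n)) _
      (hκ.comp (measurable_const.prodMk measurable_id)) _ ((exp Y weight).random_const w)

/-- Integration over the real line of families of elements of the statistical powerdomain. -/
def integral (Y : WQbs.{v}) : Hom (exp real (T Y)) (T Y) :=
  corestrict ((integralJ Y).comp (postcomp real (incl Y))) fun f hf => by
    -- Encodes the pair of parameters as one real number; `κ` is then the inverse of this coding.
    have hβ : LubClosure (randomS Y) fun t => incl Y (f (realPlane t).1 (realPlane t).2) :=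
      (mem_expRandom_iff f).1 hf _ (measurable_fst.comp realPlane.measurable) _
        (measurable_snd.comp realPlane.measurable)
    obtain ⟨g, hg, hgw⟩ := exists_lubClosure_integral hβ realPlane.symm.measurable
    convert hg using 1
    funext r
    refine Hom.ext fun w => ?_
    rw [hgw]
    simp only [realPlane.apply_symm_apply]
    rfl

/-- The index of the cell of a real number in the partition of the line into unit intervals. -/
def unitCell (s : ℝ) : ℕ := Equiv.intEquivNat ⌊s⌋

theorem measurable_unitCell : Measurable unitCell :=
  (measurable_of_countable _).comp Int.measurable_floor

/-- Countable sums in the statistical powerdomain. -/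
def sumHom (f : ℕ → Hom P (T Y)) : Hom P (T Y) :=
  -- The `n`-th summand is spread over one interval of length `1`, so that integration over the line
  -- is summation.
  (integral Y).comp (curryHom (X := real)
    { toFun := fun q => f (unitCell q.1) q.2
      cont := continuous_discr_prod _ fun s => (f (unitCell s)).cont
      random := fun γ hγ => (T Y).random_split (fun r => unitCell (γ r).1)
        (measurable_unitCell.comp hγ.1)
        (fun n r => f n (γ r).2) fun n => (f n).random _ hγ.2 })

theorem expect_sumHom (f : ℕ → Hom P (T Y)) (p : P) (w : Hom Y weight) :
    (expect w (sumHom f p) : ℝ≥0∞) = ∑' n, (expect w (f n p) : ℝ≥0∞) := by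
  change ∫⁻ s : ℝ, (expect w (f (Equiv.intEquivNat ⌊s⌋) p) : ℝ≥0∞) = _
  rw [lintegral_eq_tsum_Ico, ← Equiv.intEquivNat.tsum_eq]
  refine tsum_congr fun k => ?_
  have : ∀ t ∈ Set.Ico (0 : ℝ) 1, (expect w (f (Equiv.intEquivNat ⌊t + (k : ℝ)⌋) p) : ℝ≥0∞) =
      expect w (f (Equiv.intEquivNat k) p) := fun t ht => by
    rw [Int.floor_add_intCast, Int.floor_eq_zero_iff.2 ht, zero_add]
  rw [setLIntegral_congr_fun measurableSet_Ico this, setLIntegral_const]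
  simp

end Integral

/-! ### Scaled point masses. -/

section Dirac

variable {X : WQbs.{u}}

/-- The scaled point masses in the double exponential. -/
def diracJ (X : WQbs.{u}) : Hom (prod weight X) (J X) :=
  curryHom (mulHom.comp (pairHom (fstHom.comp sndHom)
    (evalHom.comp (pairHom (sndHom.comp sndHom) fstHom))))

open Classical in
/-- The scaled point masses `w ↦ t * w x`. -/
def dirac (X : WQbs.{u}) : Hom (prod weight X) (T X) :=
  corestrict (diracJ X) fun π hπ => by
    -- For `π r = (t, x)` the randomisation is constantly `x` on the open interval from `0` to `t`
    -- and undefined elsewhere.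
    have hγ : ∀ ρ : ℝ → ℝ, Measurable ρ → ∀ σ : ℝ → ℝ, Measurable σ →
        (fun r => if 0 < σ r ∧ ENNReal.ofReal (σ r) < (π (ρ r)).1 then
          (((π (ρ r)).2 : X) : WithBot X) else ⊥) ∈ liftRandom X := fun ρ hρ σ hσ =>
      ⟨{r | 0 < σ r ∧ ENNReal.ofReal (σ r) < (π (ρ r)).1},
        (measurableSet_lt measurable_const hσ).inter
          (measurableSet_lt (ENNReal.measurable_ofReal.comp hσ)
            ((show Measurable fun r => (π r).1 from hπ.1).comp hρ)),
        fun r hr => if_neg hr,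
        fun _ => ⟨fun r => (π (ρ r)).2, X.random_comp _ hπ.2 ρ hρ, fun r hr => if_pos hr⟩⟩
    let γ : ℝ → Hom real (lift X) := fun r => ofRandom
      (fun s => if 0 < s ∧ ENNReal.ofReal s < (π r).1 then (((π r).2 : X) : WithBot X) else ⊥)
      (hγ _ measurable_const _ measurable_id)
    refine .base _ ⟨γ, (mem_expRandom_iff γ).2 hγ, ?_⟩
    funext r
    refine Hom.ext fun w => ?_
    have hm : MeasurableSet {s : ℝ | 0 < s ∧ ENNReal.ofReal s < (π r).1} :=
      (measurableSet_lt measurable_const measurable_id).inter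
        (measurableSet_lt ENNReal.measurable_ofReal measurable_const)
    have h : ∀ s : ℝ, weigh w (γ r s) =
        {s : ℝ | 0 < s ∧ ENNReal.ofReal s < (π r).1}.indicator
          (fun _ => (w (π r).2 : ℝ≥0∞)) s := by
      intro s
      change weigh w (if 0 < s ∧ ENNReal.ofReal s < (π r).1 then _ else ⊥) = _
      by_cases hs : 0 < s ∧ ENNReal.ofReal s < (π r).1
      · rw [if_pos hs]
        exact (Set.indicator_of_mem (s := {s : ℝ | 0 < s ∧ ENNReal.ofReal s < (π r).1}) hs
          fun _ => (w (π r).2 : ℝ≥0∞)).symm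
      · rw [if_neg hs]
        exact (Set.indicator_of_notMem (s := {s : ℝ | 0 < s ∧ ENNReal.ofReal s < (π r).1}) hs
          fun _ => (w (π r).2 : ℝ≥0∞)).symm
    refine (lintegral_congr h).trans ?_
    rw [lintegral_indicator_const hm, volume_ofReal_lt, mul_comm]
    rfl

end Dirac

end WQbs

namespace WQbs

/-! ### The bind of the powerdomain. -/

section Bind

variable {X : WQbs.{u}} {Y : WQbs.{v}} {Z : WQbs.{w}}

/-- The extension of a morphism to `X_⊥` by a given value at `⊥`. -/
def extendBot (z : Z) (f : Hom X Z) : WithBot X → Z := WithBot.recBotCoe z f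

/-- Used with `Z = T Y` to build the bind, and with `Z = exp X weight` for the joint measurability
behind Tonelli's theorem. -/
theorem random_extendBot (z : Z) {f : ℝ → Hom X Z} (hf : f ∈ expRandom X Z)
    {β : ℝ → WithBot X} (hβ : β ∈ liftRandom X) :
    (fun r => extendBot z (f r) (β r)) ∈ Z.Random := by
  obtain ⟨B, hB, h₁, h₂⟩ := hβ
  obtain rfl | hne := B.eq_empty_or_nonempty
  · have : (fun r => extendBot z (f r) (β r)) = fun _ => z := by
      funext r
      rw [h₁ r (by simp)]
      rfl
    rw [this]
    exact Z.random_const z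
  · obtain ⟨α, hα, h⟩ := h₂ hne
    refine random_ite Z hB ((mem_expRandom_iff f).1 hf _ measurable_id α hα) (Z.random_const z) _
      (fun r hr => ?_) fun r hr => ?_
    · rw [h r hr]
      rfl
    · rw [h₁ r hr]
      rfl

/-- The zero element of the statistical powerdomain. -/
def zeroT (Y : WQbs.{v}) : T Y := ⟨expectation (emptyRandomisation Y), .base _ ⟨_, rfl⟩⟩

theorem expect_zeroT (w : Hom Y weight) : expect w (zeroT Y) = (0 : ℝ≥0∞) :=
  lintegral_zero

theorem expect_extendBot (f : Hom X (T Y)) (w : Hom Y weight) (x : WithBot X) :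
    expect w (extendBot (zeroT Y) f x) = weigh ((expect w).comp f) x := by
  cases x with
  | bot => exact expect_zeroT w
  | coe x => rfl

/-- The bind of the continuation monad, at Kleisli arrows into the statistical powerdomain. -/
def bindJ (X : WQbs.{u}) (Y : WQbs.{v}) : Hom (prod (J X) (exp X (T Y))) (J Y) :=
  curryHom (evalHom.comp (pairHom
    (curryHom (X := X) (Z := prod (exp Y weight) (prod (J X) (exp X (T Y))))
      (evalHom.comp (pairHom (fstHom.comp sndHom)
        ((incl Y).comp (evalHom.comp (pairHom fstHom (sndHom.comp (sndHom.comp sndHom))))))))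
    (fstHom.comp sndHom)))

/-- By continuity of bind in its first argument only randomisable operators matter. For these the
result is the line integral of `f` along the randomisation, with the zero element where it is
undefined, and `T Y` is closed under such integrals. -/
theorem lubClosure_bindJ {β : ℝ → J X} (hβ : LubClosure (randomS X) β) {f : ℝ → Hom X (T Y)}
    (hf : f ∈ expRandom X (T Y)) : LubClosure (randomS Y) fun r => bindJ X Y (β r, f r) := by
  refine hβ.map (f := fun β r => bindJ X Y (β r, f r)) (.of_apply₂ fun r => ?_) ?_
  · exact (bindJ X Y).cont.comp (Prod.ωScottContinuous.prodMk (.apply r) .const)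
  rintro _ ⟨γ, hγ, rfl⟩
  have hG : ∀ ρ : ℝ → ℝ, Measurable ρ → ∀ σ : ℝ → ℝ, Measurable σ →
      (fun r => extendBot (zeroT Y) (f (ρ r)) (γ (ρ r) (σ r))) ∈ (T Y).Random := fun ρ hρ σ hσ =>
    random_extendBot _ ((exp X (T Y)).random_comp f hf ρ hρ) ((mem_expRandom_iff γ).1 hγ ρ hρ σ hσ)
  let G : ℝ → Hom real (T Y) := fun r =>
    ofRandom (fun s => extendBot (zeroT Y) (f r) (γ r s)) (hG _ measurable_const _ measurable_id)
  have h : LubClosure (randomS Y) fun r => (integral Y (G r)).1 :=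
    (integral Y).random G ((mem_expRandom_iff G).2 hG)
  convert h using 1
  funext r
  refine Hom.ext fun w => ?_
  exact lintegral_congr fun s => (expect_extendBot (f r) w (γ r s)).symm

/-- The bind of the statistical powerdomain. -/
def bindT (X : WQbs.{u}) (Y : WQbs.{v}) : Hom (prod (T X) (exp X (T Y))) (T Y) :=
  corestrict ((bindJ X Y).comp (pairHom ((incl X).comp fstHom) sndHom)) fun _ hπ =>
    lubClosure_bindJ hπ.1 hπ.2

end Bind

/-! ### Commutation of iterated expectations. -/

section Commutativity

variable {X : WQbs.{u}} {Y : WQbs.{v}}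

def swapHom (X : WQbs.{u}) (Y : WQbs.{v}) : Hom (prod Y X) (prod X Y) := pairHom sndHom fstHom

theorem ωSup_comp_weight (c : Chain (J X)) (k : Hom Y (exp X weight)) :
    ∃ d : Chain (Hom Y weight), (∀ n, d n = (c n).comp k) ∧ (ωSup c).comp k = ωSup d :=
  ⟨⟨⟨fun n => (c n).comp k, fun _ _ h => Hom.le_def.2 fun y => Hom.le_def.1 (c.monotone h) (k y)⟩⟩,
    fun _ => rfl, rfl⟩

theorem weigh_curryHom_swap (w : Hom (prod X Y) weight) (x : X) (y : WithBot Y) :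
    weigh (curryHom (w.comp (swapHom X Y)) x) y =
      (extendBot (Z := exp X weight) 0 (curryHom w) y : Hom X weight) x := by
  cases y with
  | bot => rfl
  | coe y => rfl

theorem weigh_expectation_swap (β : R Y) (w : Hom (prod X Y) weight) (x : WithBot X) :
    weigh ((expectation β).comp (curryHom (w.comp (swapHom X Y)))) x =
      ∫⁻ s : ℝ, weigh (extendBot (Z := exp X weight) 0 (curryHom w) (Hom.toFun β s)) x := by
  cases x with
  | bot => exact lintegral_zero.symm
  | coe x => exact lintegral_congr fun s => weigh_curryHom_swap w x _

theorem weigh_zero (x : WithBot X) : weigh 0 x = 0 := by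
  cases x with
  | bot => rfl
  | coe x => rfl

theorem weigh_expectation (α : R X) (w : Hom (prod X Y) weight) (y : WithBot Y) :
    weigh ((expectation α).comp (curryHom w)) y =
      ∫⁻ r : ℝ, weigh (extendBot (Z := exp X weight) 0 (curryHom w) y) (Hom.toFun α r) := by
  cases y with
  | bot => exact ((lintegral_congr fun r => weigh_zero _).trans lintegral_zero).symm
  | coe y => rfl

/-- Tonelli's theorem for `G r s`, which is `w (α r, β s)` where both are defined and `0` elsewhere.
-/
theorem expectation_comm (α : R X) (β : R Y) (w : Hom (prod X Y) weight) :
    expectation α ((expectation β).comp (curryHom (w.comp (swapHom X Y)))) =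
      expectation β ((expectation α).comp (curryHom w)) := by
  let G : ℝ → ℝ → ℝ≥0∞ := fun r s =>
    weigh (extendBot (Z := exp X weight) 0 (curryHom w) (Hom.toFun β s)) (Hom.toFun α r)
  have hG : Measurable (Function.uncurry G) := by
    rw [← realPlane.measurable_comp_iff]
    refine measurable_weigh (X := X)
      (f := fun r => extendBot (Z := exp X weight) 0 (curryHom w) (Hom.toFun β (realPlane r).2)) ?_
      (Hom.random α _ (measurable_fst.comp realPlane.measurable))
    exact random_extendBot (Z := exp X weight) 0 ((exp Y (exp X weight)).random_const (curryHom w))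
      (Hom.random β _ (measurable_snd.comp realPlane.measurable))
  calc ∫⁻ r : ℝ, weigh ((expectation β).comp (curryHom (w.comp (swapHom X Y)))) (Hom.toFun α r)
      = ∫⁻ r : ℝ, ∫⁻ s : ℝ, G r s := lintegral_congr fun r => weigh_expectation_swap β w _
    _ = ∫⁻ s : ℝ, ∫⁻ r : ℝ, G r s := lintegral_lintegral_swap hG.aemeasurable
    _ = ∫⁻ s : ℝ, weigh ((expectation α).comp (curryHom w)) (Hom.toFun β s) :=
      (lintegral_congr fun s => weigh_expectation α w _).symm

/-- Induction on both closures. When one operator is a lub, the side where it is outermost is a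
pointwise supremum by definition; on the other side it sits inside, and the continuity of the other
operator pulls the supremum out. -/
theorem lubClosure_comm {a : J X} {b : J Y} (ha : LubClosure (S X) a) (hb : LubClosure (S Y) b)
    (w : Hom (prod X Y) weight) :
    Hom.toFun a (Hom.comp b (curryHom (w.comp (swapHom X Y)))) =
      Hom.toFun b (Hom.comp a (curryHom w)) := by
  induction ha with
  | base a ha =>
    obtain ⟨α, rfl⟩ := ha
    induction hb with
    | base b hb =>
      obtain ⟨β, rfl⟩ := hb
      exact expectation_comm α β w
    | lub c _ ih =>
      obtain ⟨d, hd, hcd⟩ := ωSup_comp_weight c (curryHom (w.comp (swapHom X Y)))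
      rw [hcd, (expectation α).cont.map_ωSup]
      refine iSup_congr fun n => ?_
      refine Eq.trans ?_ (ih n)
      rw [← hd n]
      rfl
  | lub c _ ih =>
    obtain ⟨d, hd, hcd⟩ := ωSup_comp_weight c (curryHom w)
    rw [hcd, b.cont.map_ωSup]
    refine iSup_congr fun n => ?_
    refine (ih n).trans ?_
    rw [← hd n]
    rfl

/-- Iterated expectations commute. -/
theorem expect_comm (μ : T X) (ν : T Y) (w : Hom (prod X Y) weight) :
    expect (Hom.comp ν.1 (curryHom (w.comp (swapHom X Y)))) μ =
      expect (Hom.comp μ.1 (curryHom w)) ν :=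
  lubClosure_comm μ.2 ν.2 w

end Commutativity

end WQbs

namespace WQbs

/-! ### Countable limits. -/

section Limits

variable {K : Type} [SmallCategory K] (F : K ⥤ WQbs.{u})

/-- The compatible families of a diagram. -/
abbrev Sections : Type u :=
  {x : ∀ k, F.obj k // ∀ {i j : K} (f : i ⟶ j), Hom.toFun (F.map f) (x i) = x j}

instance : OmegaCompletePartialOrder (Sections F) :=
  OmegaCompletePartialOrder.subtype _ fun c hc i j f => by
    refine ((F.map f).cont.map_ωSup _).trans ?_
    refine congrArg ωSup (Chain.ext (funext fun n => ?_))
    exact hc (c n) ⟨n, rfl⟩ f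

/-- The limit of a diagram: compatible families, with everything computed pointwise. -/
def limitSpace : WQbs.{u} where
  carrier := Sections F
  Random := {α | ∀ k, (fun r => (α r).1 k) ∈ (F.obj k).Random}
  random_const x k := (F.obj k).random_const (x.1 k)
  random_comp _ h f hf k := (F.obj k).random_comp _ (h k) f hf
  random_split N hN α h k := (F.obj k).random_split N hN (fun n r => (α n r).1 k) fun n => h n k
  random_ωSup c h k := (F.obj k).random_ωSup
    ⟨⟨fun n r => (c n r).1 k, fun _ _ hmn r => c.monotone hmn r k⟩⟩ fun n => h n k

/-- The projections of the limit. -/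
def limitProj (k : K) : Hom (limitSpace F) (F.obj k) where
  toFun x := x.1 k
  cont := ωScottContinuous.of_monotone_map_ωSup ⟨fun _ _ h => h k, fun _ => rfl⟩
  random _ h := h k

def limitCone : Cone F where
  pt := limitSpace F
  π := { app := limitProj F
         naturality := fun _ _ f => Hom.ext fun x => (x.2 f).symm }

def limitConeIsLimit : IsLimit (limitCone F) where
  lift s :=
    { toFun := fun x => ⟨fun k => Hom.toFun (s.π.app k) x, fun f =>
        congrArg (fun g => Hom.toFun g x) (s.w f)⟩
      cont := ωScottContinuous.of_monotone_map_ωSup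
        ⟨fun _ _ h k => (s.π.app k).cont.monotone h,
          fun c => Subtype.ext (funext fun k => (s.π.app k).cont.map_ωSup c)⟩
      random := fun α hα k => (s.π.app k).random α hα }
  fac _ _ := rfl
  uniq _ _ h := Hom.ext fun x => Subtype.ext (funext fun k =>
    congrArg (fun g => Hom.toFun g x) (h k))

theorem hasCountableLimits : HasCountableLimits WQbs.{u} where
  out _ _ _ := ⟨fun F => ⟨⟨limitCone F, limitConeIsLimit F⟩⟩⟩

end Limits

/-! ### Countable coproducts as disjoint unions. -/

section Coproducts

section Order

variable {ι : Type v} {α : ι → Type u}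

open Classical in
/-- The projection of a disjoint union to a summand, with a default value elsewhere. -/
def sigmaProj (i : ι) (x : α i) (a : Σ i, α i) : α i :=
  if h : a.1 = i then h ▸ a.2 else x

theorem sigmaProj_mk (i : ι) (x y : α i) : sigmaProj i x ⟨i, y⟩ = y := dif_pos rfl

theorem sigmaProj_of_ne {i : ι} (x : α i) {a : Σ i, α i} (h : a.1 ≠ i) : sigmaProj i x a = x :=
  dif_neg h

theorem mk_sigmaProj {i : ι} (x : α i) {a : Σ i, α i} (h : a.1 = i) :
    (⟨i, sigmaProj i x a⟩ : Σ i, α i) = a := by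
  obtain ⟨j, y⟩ := a
  obtain rfl : j = i := h
  rw [sigmaProj_mk]

variable [∀ i, OmegaCompletePartialOrder (α i)]

theorem sigma_fst_eq_of_le {a b : Σ i, α i} (h : a ≤ b) : a.1 = b.1 := (Sigma.le_def.1 h).1

theorem sigmaProj_mono (i : ι) (x : α i) : Monotone (sigmaProj i x) := by
  rintro _ _ ⟨j, a, b, h⟩
  by_cases hj : j = i
  · subst hj
    simpa only [sigmaProj_mk] using h
  · rw [sigmaProj_of_ne x (a := ⟨j, a⟩) hj, sigmaProj_of_ne x (a := ⟨j, b⟩) hj]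

theorem chain_fst_eq (c : Chain (Σ i, α i)) (n : ℕ) : (c n).1 = (c 0).1 :=
  (sigma_fst_eq_of_le (c.monotone (Nat.zero_le n))).symm

/-- Comparable elements lie in the same summand, so a chain stays in that of `c 0` and the default
value `(c 0).2` is never used. -/
instance : OmegaCompletePartialOrder (Σ i, α i) where
  ωSup c := ⟨(c 0).1, ωSup (c.map ⟨sigmaProj (c 0).1 (c 0).2, sigmaProj_mono _ _⟩)⟩
  le_ωSup c n := by
    rw [← mk_sigmaProj (c 0).2 (chain_fst_eq c n), Sigma.mk_le_mk_iff]
    exact le_ωSup (c.map ⟨sigmaProj (c 0).1 (c 0).2, sigmaProj_mono _ _⟩) n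
  ωSup_le c x h := by
    rw [← mk_sigmaProj (c 0).2 (sigma_fst_eq_of_le (h 0)).symm, Sigma.mk_le_mk_iff]
    exact ωSup_le _ _ fun n => sigmaProj_mono _ _ (h n)

theorem ωSup_sigma_fst (c : Chain (Σ i, α i)) : (ωSup c).1 = (c 0).1 := rfl

theorem sigmaProj_cont (i : ι) (x : α i) : ωScottContinuous (sigmaProj i x) := by
  refine ωScottContinuous.of_monotone_map_ωSup ⟨sigmaProj_mono i x, fun c => ?_⟩
  by_cases hi : (c 0).1 = i
  · subst hi
    refine (sigmaProj_mk _ _ _).trans (congrArg ωSup (Chain.ext (funext fun n => ?_)))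
    change sigmaProj _ _ (c n) = sigmaProj _ _ (c n)
    obtain ⟨y, hy⟩ : ∃ y, c n = ⟨(c 0).1, y⟩ := ⟨_, (mk_sigmaProj (c 0).2 (chain_fst_eq c n)).symm⟩
    rw [hy, sigmaProj_mk, sigmaProj_mk]
  · rw [sigmaProj_of_ne x (by rwa [ωSup_sigma_fst])]
    have h : ∀ n, sigmaProj i x (c n) = x := fun n =>
      sigmaProj_of_ne x (by rwa [chain_fst_eq c n])
    refine le_antisymm (le_ωSup_of_le (c := c.map ⟨_, sigmaProj_mono i x⟩) 0 (h 0).ge)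
      (ωSup_le _ _ fun n => (h n).le)

theorem sigmaMk_cont (i : ι) : ωScottContinuous (Sigma.mk i : α i → Σ i, α i) := by
  refine ωScottContinuous.of_monotone_map_ωSup ⟨fun _ _ h => Sigma.mk_le_mk_iff.2 h, fun c => ?_⟩
  refine congrArg (Sigma.mk i) (congrArg ωSup (Chain.ext (funext fun n => ?_)))
  exact (sigmaProj_mk i _ (c n)).symm

theorem sigma_desc_cont {β : Type w} [OmegaCompletePartialOrder β] (f : ∀ i, α i → β)
    (hf : ∀ i, ωScottContinuous (f i)) : ωScottContinuous fun a : Σ i, α i => f a.1 a.2 := by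
  have hmono : Monotone fun a : Σ i, α i => f a.1 a.2 := by
    rintro _ _ ⟨i, a, b, h⟩
    exact (hf i).monotone h
  refine ωScottContinuous.of_monotone_map_ωSup ⟨hmono, fun c => ?_⟩
  refine ((hf _).map_ωSup _).trans (congrArg ωSup (Chain.ext (funext fun n => ?_)))
  change f (c 0).1 (sigmaProj _ _ (c n)) = f (c n).1 (c n).2
  exact congrArg (fun a : Σ i, α i => f a.1 a.2) (mk_sigmaProj (c 0).2 (chain_fst_eq c n))

end Order

variable {ι : Type} [Countable ι] (X : ι → WQbs.{u})

/-- The coproduct of countably many spaces: the disjoint union. A random element is given by a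
countable Borel partition of the line and random elements of the summands on its cells. -/
def sigma : WQbs.{u} where
  carrier := Σ i, X i
  -- Quantifying over the default `x` makes the second condition vacuous for an empty summand, which
  -- has no default to offer.
  Random := {α | ∀ i, MeasurableSet {r | (α r).1 = i} ∧
    ∀ x : X i, (fun r => sigmaProj (α := fun i => X i) i x (α r)) ∈ (X i).Random}
  random_const a i := ⟨MeasurableSet.const _, fun x => (X i).random_const _⟩
  random_comp _ h f hf i := ⟨hf (h i).1, fun x => (X i).random_comp _ ((h i).2 x) f hf⟩
  random_split N hN α h i := by
    refine ⟨?_, fun x => (X i).random_split N hN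
      (fun n r => sigmaProj (α := fun i => X i) i x (α n r)) fun n => (h n i).2 x⟩
    have : {r | (α (N r) r).1 = i} = ⋃ n, N ⁻¹' {n} ∩ {r | (α n r).1 = i} := by
      ext r
      simp
    rw [this]
    exact MeasurableSet.iUnion fun n => (hN (measurableSet_singleton n)).inter (h n i).1
  random_ωSup c h i := by
    refine ⟨(h 0 i).1, fun x => ?_⟩
    have : (fun r => sigmaProj (α := fun i => X i) i x (ωSup c r)) =
        ωSup (⟨⟨fun n r => sigmaProj (α := fun i => X i) i x (c n r), fun _ _ hmn r =>
          sigmaProj_mono (α := fun i => X i) i x (c.monotone hmn r)⟩⟩ : Chain (ℝ → X i)) :=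
      funext fun r => (sigmaProj_cont (α := fun i => X i) i x).map_ωSup _
    rw [this]
    exact (X i).random_ωSup _ fun n => (h n i).2 x

/-- The injections of the coproduct. -/
def sigmaInj (i : ι) : Hom (X i) (sigma X) where
  toFun x := ⟨i, x⟩
  cont := sigmaMk_cont (α := fun i => X i) i
  random α hα j := by
    refine ⟨MeasurableSet.const (i = j), fun x => ?_⟩
    by_cases h : i = j
    · subst h
      simpa only [sigmaProj_mk (α := fun i => X i)] using hα
    · simp only [sigmaProj_of_ne (α := fun i => X i) x (a := ⟨i, _⟩) h]
      exact (X j).random_const x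

variable {X}

/-- The copairing out of the coproduct. -/
def sigmaDesc {Y : WQbs.{v}} (f : ∀ i, Hom (X i) Y) : Hom (sigma X) Y where
  toFun a := f a.1 a.2
  cont := sigma_desc_cont (α := fun i => X i) (fun i => f i) fun i => (f i).cont
  random α hα := by
    classical
    obtain ⟨e, he⟩ := exists_injective_nat ι
    -- The default for each summand is a value that `α` itself takes there, so summands need not be
    -- nonempty. Indices that `α` never reaches get an arbitrary constant.
    let β : ℕ → ℝ → Y := fun n r =>
      if h : ∃ s, e (α s).1 = n then
        f _ (sigmaProj (α := fun i => X i) (α h.choose).1 (α h.choose).2 (α r))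
      else f (α 0).1 (α 0).2
    have hN : Measurable fun r => e (α r).1 := by
      refine measurable_to_countable' fun n => ?_
      by_cases h : ∃ i, e i = n
      · obtain ⟨i, rfl⟩ := h
        convert (hα i).1 using 1
        ext r
        simp [he.eq_iff]
      · convert MeasurableSet.empty using 1
        ext r
        simp only [Set.mem_preimage, Set.mem_singleton_iff, Set.mem_empty_iff_false, iff_false]
        exact fun hr => h ⟨_, hr⟩
    have hβ : ∀ n, β n ∈ Y.Random := by
      intro n
      by_cases h : ∃ s, e (α s).1 = n
      · simp only [β, dif_pos h]
        exact (f _).random _ ((hα _).2 _)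
      · simp only [β, dif_neg h]
        exact Y.random_const _
    convert Y.random_split _ hN β hβ using 1
    funext r
    have h : ∃ s, e (α s).1 = e (α r).1 := ⟨r, rfl⟩
    simp only [β, dif_pos h]
    exact congrArg (fun a : Σ i, X i => f a.1 a.2)
      (mk_sigmaProj (α := fun i => X i) (α h.choose).2 (he h.choose_spec).symm).symm

variable (X)

def sigmaCofan : Cofan X := Cofan.mk (sigma X) (sigmaInj X)

def sigmaCofanIsColimit : IsColimit (sigmaCofan X) :=
  Cofan.IsColimit.mk _ (fun s => sigmaDesc s.inj) (fun _ _ => rfl)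
    fun _ _ h => Hom.ext fun a => congrArg (fun g => Hom.toFun g a.2) (h a.1)

theorem hasCountableCoproducts : HasCountableCoproducts WQbs.{u} where
  out K _ := ⟨fun F => by
    have : HasColimit (Discrete.functor (F.obj ∘ Discrete.mk)) :=
      ⟨⟨sigmaCofan _, sigmaCofanIsColimit _⟩⟩
    exact hasColimit_of_iso (Discrete.natIsoFunctor (F := F))⟩

/-- The injections into a coproduct are jointly surjective. -/
theorem exists_sigma_ι_eq [HasCoproduct X] (z : (∐ X : WQbs.{u})) :
    ∃ i, ∃ x : X i, Hom.toFun (Sigma.ι X i) x = z := by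
  -- The chosen coproduct is abstract; the round trip through the explicit disjoint union is the
  -- identity and exhibits `z` as the image of an element of a summand.
  let d : (∐ X : WQbs.{u}) ⟶ sigma X := Sigma.desc (sigmaInj X)
  let j : sigma X ⟶ ∐ X := sigmaDesc (Sigma.ι X)
  have hdj : d ≫ j = 𝟙 _ := by
    refine Sigma.hom_ext _ _ fun i => ?_
    rw [Sigma.ι_desc_assoc, Category.comp_id]
    rfl
  exact ⟨(Hom.toFun d z).1, (Hom.toFun d z).2, congrArg (fun g => Hom.toFun g z) hdj⟩

/-- The initial object maps to the empty disjoint union. -/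
theorem isEmpty_initial [HasInitial WQbs.{u}] : IsEmpty (⊥_ WQbs.{u}) := by
  let d : (⊥_ WQbs.{u}) ⟶ sigma fun i : Empty => (i.elim : WQbs.{u}) := initial.to _
  exact ⟨fun z => (Hom.toFun d z).1.elim⟩

end Coproducts

end WQbs

namespace WQbs

open StrongMonadStructure

/-! ### The strong monad, its laws and its commutativity. -/

/-- The unit of the statistical powerdomain. -/
def retT (X : WQbs.{u}) : Hom X (T X) :=
  (dirac X).comp (pairHom
    ⟨fun _ => (1 : ℝ≥0∞), ωScottContinuous.const, fun _ _ => measurable_const⟩ (Hom.id X))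

theorem expect_retT {X : WQbs.{u}} (x : X) (w : Hom X weight) : expect w (retT X x) = w x :=
  one_mul (w x : ℝ≥0∞)

/-- The strong monad structure of the statistical powerdomain. -/
def monadT : StrongMonadStructure T.{u} where
  ret := retT
  bind := bindT

variable {Γ X Y : WQbs.{u}}

/-- The partial application of a morphism out of a product. -/
def fixSnd (k : Hom (prod X Γ) Y) (γ : Γ) : Hom X Y := Hom.toFun (curryHom k) γ

theorem expect_bindIn (a : Γ ⟶ T X) (k : X ⊗ Γ ⟶ T Y) (γ : Γ) (w : Hom Y weight) :
    expect w (Hom.toFun (monadT.bindIn a k) γ) =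
      expect ((expect w).comp (fixSnd k γ)) (Hom.toFun a γ) := rfl

theorem expect_ext (f : X ⟶ T Y) (a : T X) (w : Hom Y weight) :
    expect w (Hom.toFun (monadT.ext f) a) = expect ((expect w).comp f) a := rfl

theorem expect_map (f : X ⟶ Y) (a : T X) (w : Hom Y weight) :
    expect w (Hom.toFun (monadT.map f) a) = expect (Hom.comp w f) a := by
  refine (expect_ext (f ≫ monadT.ret Y) a w).trans ?_
  congr 1
  exact congrArg expect (Hom.ext fun x => expect_retT _ w)

/-- As in the continuation monad, associativity is definitional. The unit laws reduce to
`expect_retT`, that is, to multiplication by the weight `1`. -/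
theorem isStrongMonad_monadT : monadT.{u}.IsStrongMonad where
  ret_bind x f := Hom.ext fun γ => T_ext fun w => expect_retT _ _
  bind_ret a := Hom.ext fun γ => T_ext fun w => by
    refine (expect_bindIn _ _ γ w).trans ?_
    exact congrArg (fun v => expect v (Hom.toFun a γ)) (Hom.ext fun x => expect_retT x w)
  bind_assoc a f g := rfl

theorem isCommutative_monadT : monadT.{u}.IsCommutative := by
  intro Γ X Y a b
  refine Hom.ext fun γ => T_ext fun w => ?_
  refine (congrArg (fun v => expect v (Hom.toFun a γ)) (Hom.ext fun x => ?_)).trans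
    ((expect_comm (Hom.toFun a γ) (Hom.toFun b γ) w).trans
      (congrArg (fun v => expect v (Hom.toFun b γ)) (Hom.ext fun y => ?_)).symm)
  · exact congrArg (fun v => expect v (Hom.toFun b γ)) (Hom.ext fun y => expect_retT (x, y) w)
  · exact congrArg (fun v => expect v (Hom.toFun a γ)) (Hom.ext fun x => expect_retT (x, y) w)

theorem expect_of_isEmpty [IsEmpty X] (μ : T X) (w : Hom X weight) :
    expect w μ = (0 : ℝ≥0∞) := by
  rw [show w = 0 from Hom.ext fun x => isEmptyElim x]
  exact expect_zero μ

/-- On an empty space the only weight is `0`, so linearity leaves the zero element as the only one.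
-/
theorem isIso_toUnit_T [IsEmpty X] : IsIso (toUnit (T X)) := by
  refine ⟨⟨⟨fun _ => zeroT X, ωScottContinuous.const, fun _ _ => (T X).random_const _⟩,
    Hom.ext fun μ => T_ext fun w => ?_, toUnit_unique _ _⟩⟩
  exact (expect_zeroT w).trans (expect_of_isEmpty μ w).symm

/-! ### The comparison morphism from a coproduct to the product of the powerdomains. -/

section Coproduct

variable [HasCountableCoproducts WQbs.{u}]

theorem desc_ι_apply (X : ℕ → WQbs.{u}) {Y : WQbs.{u}} (f : ∀ i, X i ⟶ Y) (i : ℕ) (x : X i) :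
    Hom.toFun (Sigma.desc f) (Hom.toFun (Sigma.ι X i) x) = Hom.toFun (f i) x :=
  congrArg (fun g => Hom.toFun g x) (Sigma.ι_desc f i)

/-- The sum of a family of elements of the summands. -/
def fromPi [HasCountableLimits WQbs.{u}] (X : ℕ → WQbs.{u}) : (∏ᶜ fun j => T (X j)) ⟶ T (∐ X) :=
  sumHom fun i => Pi.π (fun j => T (X j)) i ≫ monadT.map (Sigma.ι X i)

theorem expect_fromPi [HasCountableLimits WQbs.{u}] (X : ℕ → WQbs.{u})
    (p : (∏ᶜ fun j => T (X j) : WQbs.{u})) (w : Hom (∐ X) weight) :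
    (expect w (Hom.toFun (fromPi X) p) : ℝ≥0∞) =
      ∑' i, (expect (Hom.comp w (Sigma.ι X i)) (Hom.toFun (Pi.π (fun j => T (X j)) i) p) : ℝ≥0∞) :=
  (expect_sumHom _ p w).trans (tsum_congr fun i =>
    expect_map (Sigma.ι X i) (Hom.toFun (Pi.π (fun j => T (X j)) i) p) w)

variable [IsIso (toUnit (T (⊥_ WQbs.{u})))]

theorem expect_zero_monadT (X : WQbs.{u}) (t : 𝟙_ WQbs.{u}) (w : Hom X weight) :
    expect w (Hom.toFun (monadT.zero X) t) = (0 : ℝ≥0∞) := by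
  have := isEmpty_initial.{u}
  exact (expect_map _ _ w).trans (expect_of_isEmpty _ _)

theorem expect_delta_self (X : ℕ → WQbs.{u}) (i : ℕ) (x : X i) (w : Hom (X i) weight) :
    expect w (Hom.toFun (monadT.delta X i i) x) = w x := by
  have : monadT.delta X i i = monadT.ret (X i) := by
    simp [delta]
  rw [this]
  exact expect_retT x w

theorem expect_delta_of_ne (X : ℕ → WQbs.{u}) {i j : ℕ} (h : i ≠ j) (x : X i)
    (w : Hom (X j) weight) : expect w (Hom.toFun (monadT.delta X i j) x) = (0 : ℝ≥0∞) := by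
  rw [delta, dif_neg h]
  exact expect_zero_monadT _ _ w

/-- The component at `j` of the comparison morphism. -/
def component (X : ℕ → WQbs.{u}) (j : ℕ) : T (∐ X) ⟶ T (X j) :=
  monadT.ext (Sigma.desc fun i => monadT.delta X i j)

/-- An element of `T (∑ i, X i)` is the sum of its components. -/
theorem expect_eq_tsum_component (X : ℕ → WQbs.{u}) (a : T (∐ X)) (w : Hom (∐ X) weight) :
    (expect w a : ℝ≥0∞) =
      ∑' j, (expect (Hom.comp w (Sigma.ι X j)) (Hom.toFun (component X j) a) : ℝ≥0∞) := by
  -- The `j`-th term is `w` on the `j`-th summand and `0` on the others, so these terms add up to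
  -- `w`.
  refine expect_tsum a (fun j => (expect (Hom.comp w (Sigma.ι X j))).comp
    (Sigma.desc fun i => monadT.delta X i j)) w fun z => ?_
  obtain ⟨i, x, rfl⟩ := exists_sigma_ι_eq X z
  have h : ∀ j, ((expect (Hom.comp w (Sigma.ι X j))).comp
      (Sigma.desc fun i => monadT.delta X i j)) (Hom.toFun (Sigma.ι X i) x) =
      expect (Hom.comp w (Sigma.ι X j)) (Hom.toFun (monadT.delta X i j) x) := fun j =>
    congrArg (expect (Hom.comp w (Sigma.ι X j))) (desc_ι_apply X _ i x)
  simp only [h]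
  rw [tsum_eq_single i fun j hj => expect_delta_of_ne X hj.symm x _]
  exact (expect_delta_self X i x (Hom.comp w (Sigma.ι X i))).symm

variable [HasCountableLimits WQbs.{u}]

theorem toPi_comp_π (X : ℕ → WQbs.{u}) (j : ℕ) :
    monadT.toPi X ≫ Pi.π (fun j => T (X j)) j = component X j :=
  Pi.lift_π _ _

/-- One composite is the decomposition `expect_eq_tsum_component`. In the other, the `j`-th
component of a sum retains only the `j`-th term, since the Kleisli arrow `delta` is the unit on that
summand and zero on the rest. -/
theorem isIso_toPi_monadT (X : ℕ → WQbs.{u}) : IsIso (monadT.toPi X) := by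
  refine ⟨⟨fromPi X, ?_, ?_⟩⟩
  · refine Hom.ext fun a => T_ext fun w => ?_
    refine (expect_fromPi X (Hom.toFun (monadT.toPi X) a) w).trans
      ((expect_eq_tsum_component X a w).trans (tsum_congr fun j => ?_)).symm
    rw [← toPi_comp_π X j]
    rfl
  · refine Pi.hom_ext _ _ fun j => ?_
    rw [Category.assoc, toPi_comp_π, Category.id_comp]
    refine Hom.ext fun p => T_ext fun w => ?_
    refine (expect_fromPi X p ((expect w).comp (Sigma.desc fun i => monadT.delta X i j))).trans ?_
    rw [tsum_eq_single j]
    · refine congrArg (fun v => expect v (Hom.toFun (Pi.π (fun j => T (X j)) j) p))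
        (Hom.ext fun x => ?_)
      exact (congrArg (expect w) (desc_ι_apply X (fun i => monadT.delta X i j) j x)).trans
        (expect_delta_self X j x w)
    · intro i hij
      refine Eq.trans ?_ (expect_zero (Hom.toFun (Pi.π (fun j => T (X j)) i) p))
      refine congrArg (fun v => expect v (Hom.toFun (Pi.π (fun j => T (X j)) i) p))
        (Hom.ext fun x => ?_)
      exact (congrArg (expect w) (desc_ι_apply X (fun i => monadT.delta X i j) i x)).trans
        (expect_delta_of_ne X hij x w)

end Coproduct

theorem isMeasureCategory_monadT : monadT.{u}.IsMeasureCategory :=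
  haveI := hasCountableLimits.{u}
  haveI := hasCountableCoproducts.{u}
  haveI := isEmpty_initial.{u}
  haveI := isIso_toUnit_T (X := ⊥_ WQbs.{u})
  { hasCountableLimits := inferInstance
    hasCountableCoproducts := inferInstance
    isStrongMonad := isStrongMonad_monadT
    isCommutative := isCommutative_monadT
    isIso_toUnit := inferInstance
    isIso_toPi := isIso_toPi_monadT }

/-! ### The scalars and their total mass. -/

section Scalars

/-- The constant weight `1`. -/
def oneWeight (X : WQbs.{u}) : Hom X weight :=
  ⟨fun _ => (1 : ℝ≥0∞), ωScottContinuous.const, fun _ _ => measurable_const⟩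

/-- The total mass. -/
def mass (X : WQbs.{u}) : Hom (T X) weight := expect (oneWeight X)

/-- The scalar with a given mass. -/
def ofMass : Hom weight (T (𝟙_ WQbs.{u})) :=
  (dirac (𝟙_ WQbs.{u})).comp (pairHom (Hom.id weight)
    ⟨fun _ => PUnit.unit, ωScottContinuous.const, fun _ _ => trivial⟩)

theorem mass_ofMass (t : weight) : mass _ (ofMass.{u} t) = t := mul_one (t : ℝ≥0∞)

/-- A weight on the one-point space is a multiple of the constant `1`, so linearity reduces every
expectation to the mass. -/
theorem expect_scalar (a : T (𝟙_ WQbs.{u})) (w : Hom (𝟙_ WQbs.{u}) weight) :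
    expect w a = (mass _ a * w PUnit.unit : ℝ≥0∞) := by
  have h : w = (w PUnit.unit : ℝ≥0∞) • oneWeight (𝟙_ WQbs.{u}) :=
    Hom.ext fun x => (mul_one (w PUnit.unit : ℝ≥0∞)).symm
  conv_lhs => rw [h]
  rw [mul_comm]
  exact (expect_isLinearMap a).map_smul _ _

theorem ofMass_mass (a : T (𝟙_ WQbs.{u})) : ofMass (mass _ a) = a :=
  T_ext fun w => (expect_scalar a w).symm

theorem mass_scalarSum (h : monadT.{u}.IsMeasureCategory) {Γ : WQbs.{u}}
    (s : ℕ → (Γ ⟶ T (𝟙_ WQbs.{u}))) (γ : Γ) :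
    (mass _ (Hom.toFun (scalarSum h s) γ) : ℝ≥0∞) = ∑' n, (mass _ (Hom.toFun (s n) γ) : ℝ≥0∞) := by
  have := h.hasCountableLimits
  have := h.hasCountableCoproducts
  have := h.isIso_toUnit
  have := h.isIso_toPi
  -- The element with components `s n`; collapsing the coproduct to a point preserves its mass,
  -- which is the sum of the masses of its components.
  let z : Γ ⟶ T (∐ fun _ : ℕ => 𝟙_ WQbs.{u}) := Pi.lift s ≫ inv (monadT.toPi fun _ => 𝟙_ WQbs.{u})
  have hz : ∀ n, z ≫ component (fun _ => 𝟙_ WQbs.{u}) n = s n := fun n => by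
    rw [← toPi_comp_π, Category.assoc, IsIso.inv_hom_id_assoc, Pi.lift_π]
  have hs : scalarSum h s = z ≫ monadT.map (Sigma.desc fun _ => 𝟙 (𝟙_ WQbs.{u})) := by
    rw [Category.assoc]
    rfl
  rw [hs]
  refine (expect_map _ _ _).trans ((expect_eq_tsum_component _ _ _).trans ?_)
  exact tsum_congr fun n => by
    rw [← hz n]
    rfl

theorem mass_scalarZero (h : monadT.{u}.IsMeasureCategory) {Γ : WQbs.{u}} (γ : Γ) :
    (mass _ (Hom.toFun (scalarZero h Γ) γ) : ℝ≥0∞) = 0 :=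
  haveI := h.hasCountableCoproducts
  haveI := h.isIso_toUnit
  expect_zero_monadT _ _ _

theorem mass_scalarAdd (h : monadT.{u}.IsMeasureCategory) {Γ : WQbs.{u}}
    (a b : Γ ⟶ T (𝟙_ WQbs.{u})) (γ : Γ) :
    (mass _ (Hom.toFun (scalarAdd h a b) γ) : ℝ≥0∞) =
      mass _ (Hom.toFun a γ) + mass _ (Hom.toFun b γ) := by
  refine (mass_scalarSum h _ γ).trans ?_
  rw [tsum_eq_sum (s := Finset.range 2)]
  · simp [Finset.sum_range_succ]
  · intro n hn
    match n with
    | 0 => simp at hn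
    | 1 => simp at hn
    | n + 2 => exact mass_scalarZero h γ

theorem mass_scalarMul {Γ : WQbs.{u}} (a b : Γ ⟶ T (𝟙_ WQbs.{u})) (γ : Γ) :
    (mass _ (Hom.toFun (monadT.scalarMul a b) γ) : ℝ≥0∞) =
      mass _ (Hom.toFun a γ) * mass _ (Hom.toFun b γ) :=
  expect_scalar (Hom.toFun a γ) ((mass _).comp (fixSnd (snd (𝟙_ WQbs.{u}) Γ ≫ b) γ))

theorem mass_scalarOne {Γ : WQbs.{u}} (γ : Γ) :
    (mass _ (Hom.toFun (monadT.scalarOne Γ) γ) : ℝ≥0∞) = 1 :=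
  expect_retT _ _

end Scalars

end WQbs

end

/-- The statistical powerdomain `T`, with the unit and the bind of the continuation monad `J`,
makes `ω`-quasi-Borel spaces into a measure category; the countable semiring of scalars `T 1` is
`[0,∞]`; and the elements of `T X` are linear. -/
theorem mainTheorem3 :
    ∃ M : StrongMonadStructure WQbs.T.{u},
      (∀ (X : WQbs.{u}) (x : X) (w : WQbs.Hom X WQbs.weight),
        WQbs.expect w (M.ret X x) = w x) ∧
      (∀ (X Y : WQbs.{u}) (a : WQbs.T X) (f : WQbs.Hom X (WQbs.T Y))
          (w : WQbs.Hom Y WQbs.weight),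
        WQbs.expect w (WQbs.Hom.toFun (M.bind X Y) (a, f)) =
          WQbs.expect ((WQbs.expect w).comp f) a) ∧
      (∃ h : M.IsMeasureCategory,
        ∃ (φ : WQbs.Hom (WQbs.T (𝟙_ WQbs.{u})) WQbs.weight)
          (ψ : WQbs.Hom WQbs.weight (WQbs.T (𝟙_ WQbs.{u}))),
          (∀ a, ψ (φ a) = a) ∧ (∀ t, φ (ψ t) = t) ∧
          ∀ (Γ : WQbs.{u}) (γ : Γ),
            (∀ s : ℕ → (Γ ⟶ WQbs.T (𝟙_ WQbs.{u})),
              φ (StrongMonadStructure.scalarSum h s γ) = ∑' n, (φ (s n γ) : ℝ≥0∞)) ∧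
            (∀ a b : Γ ⟶ WQbs.T (𝟙_ WQbs.{u}),
              φ (StrongMonadStructure.scalarAdd h a b γ) = (φ (a γ) + φ (b γ) : ℝ≥0∞)) ∧
            φ (StrongMonadStructure.scalarZero h Γ γ) = (0 : ℝ≥0∞) ∧
            (∀ a b : Γ ⟶ WQbs.T (𝟙_ WQbs.{u}),
              φ (M.scalarMul a b γ) = (φ (a γ) * φ (b γ) : ℝ≥0∞)) ∧
            φ (M.scalarOne Γ γ) = (1 : ℝ≥0∞)) ∧
      (∀ (X : WQbs.{u}) (μ : WQbs.T X),
        IsLinearMap ℝ≥0∞ fun w : WQbs.Hom X WQbs.weight => (WQbs.expect w μ : ℝ≥0∞)) := by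
  exact ⟨WQbs.monadT, fun _ x w => WQbs.expect_retT x w, fun _ _ _ _ _ => rfl,
    ⟨WQbs.isMeasureCategory_monadT, WQbs.mass _, WQbs.ofMass, WQbs.ofMass_mass,
      WQbs.mass_ofMass.{u},
      fun Γ γ => ⟨fun s => WQbs.mass_scalarSum _ s γ, fun a b => WQbs.mass_scalarAdd _ a b γ,
        WQbs.mass_scalarZero _ γ, fun a b => WQbs.mass_scalarMul a b γ, WQbs.mass_scalarOne γ⟩⟩,
    fun _ μ => WQbs.expect_isLinearMap μ⟩
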